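/- **Setting.** Let $\Lambda(k),\Omega(k)$ be $N\times N$ matrix polynomials in the spectral parameter $k$ which commute with each other (for example, diagonal ones), and put $E(k)=E(k,x,t)=\exp\{-\Lambda(k)x-\Omega(k)t\}$, $x,t\in\mathbb R$. Let $(k_1,\bar k_1),\dots,(k_{N_Z},\bar k_{N_Z})$ be pairs of complex numbers, the $k_n$ distinct, the $\bar k_n$ distinct, and $k_m\neq\bar k_n$ for all $m,n$ (the bar need not be complex conjugation). To the $n$-th pair belong a geometric multiplicity $r_1^{(n)}\ge 1$ and a block sequence $s^{(n)}_1\ge\dots\ge s^{(n)}_{r_1^{(n)}}\ge 1$. Enumerate all blocks of all pairs by $\nu$, and let $s_\nu$ be the size of block $\nu$ and $(\kappa_\nu,\bar\kappa_\nu)$ the pair to which it belongs. *$p$-vectors* are columns $|p^{(\nu)}_i\rangle\in\mathbb C^N$ and rows $\langle\bar p^{(\nu)}_i|$, $1\le i\le s_\nu$; let $P$ be the matrix with the columns $|p_i^{(\nu)}\rangle$ and $\bar P$ the matrix with the rows $\langle\bar p_i^{(\nu)}|$. Let $\mathcal D(k)$, $\overline{\mathcal D}(k)$ be the block-diagonal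 matrices with blocks $$(D_\nu(k))_{\alpha\beta}=\begin{cases}(k-\kappa_\nu)^{-(\beta-\alpha+1)},&\alpha\le\beta,\\0,&\alpha>\beta,\end{cases}\qquad(\bar D_\nu(k))_{\alpha\beta}=\begin{cases}(k-\bar\kappa_\nu)^{-(\alpha-\beta+1)},&\beta\le\alpha,\\0,&\beta>\alpha.\end{cases}$$ Let $\overline{\mathcal K}$, $\mathcal K$ be the matrices with blocks $$\bar K^{(\nu,\mu)}=\sum_{j=0}^{s_\nu-1}\sum_{l=0}^{s_\mu-1}\frac{(-1)^l(j+l)!}{j!\,l!}\frac{H_{-j}\bar Q_l^{(\nu,\mu)}}{(\kappa_\mu-\bar\kappa_\nu)^{j+l+1}},\qquad K^{(\nu,\mu)}=\sum_{l=0}^{s_\nu-1}\sum_{j=0}^{s_\mu-1}\frac{(-1)^l(l+j)!}{l!\,j!}\frac{Q_l^{(\nu,\mu)}H_j}{(\bar\kappa_\nu-\kappa_\mu)^{l+j+1}},$$ where $(H_j)_{\alpha\beta}=\delta_{\alpha,\beta-j}$, $\bar Q_l^{(\nu,\mu)}$ is the matrix $(\langle\bar p^{(\nu)}_\alpha|p^{(\mu)}_\beta\rangle)_{\alpha\beta}$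 shifted $l$ columns to the right, and $Q_l^{(\nu,\mu)}$ is the same matrix shifted $l$ rows down (vacated entries are $0$). The vectors are *$p$-vectors of* a soliton matrix $\Gamma(k)$ if $\mathcal K,\overline{\mathcal K}$ are non-degenerate and, away from the poles, $$\Gamma(k)=I-P\,\overline{\mathcal K}^{-1}\overline{\mathcal D}(k)\bar P,\qquad \Gamma^{-1}(k)=I-P\,\mathcal D(k)\mathcal K^{-1}\bar P .$$ For a matrix function $F(k)$ let $\mathbf F_\nu(k)$ be the lower-triangular block-Toeplitz matrix with $s_\nu\times s_\nu$ blocks whose $(i,j)$ block is $\frac1{(i-j)!}\frac{d^{i-j}F}{dk^{i-j}}$ for $i\ge j$ and $0$ otherwise, and $\overline{\mathbf F}_\nu(k)$ the upper-triangular one with $(i,j)$ block $\frac1{(j-i)!}\frac{d^{j-i}F}{dk^{j-i}}$ for $i\le j$; write $\mathbf\Gamma_\nu,\mathbf\Lambda_\nu,\mathbf\Omega_\nu$ for $F=\Gamma,\Lambda,\Omega$, and $\overline{\mathbf\Gamma}_\nu,\overline{\mathbf\Lambda}_\nu,\overline{\mathbf\Omega}_\nu$ for $F=\Gamma^{-1},\Lambda,\Omega$.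 Write $\mathbf p_\nu$ for the stacked column $(|p_1^{(\nu)}\rangle,\dots,|p_{s_\nu}^{(\nu)}\rangle)^T$ and $\bar{\mathbf p}_\nu=(\langle\bar p_1^{(\nu)}|,\dots,\langle\bar p_{s_\nu}^{(\nu)}|)$. *Invariance transformations* are $P\mapsto PB$, $\bar P\mapsto\bar B\bar P$ with non-degenerate matrices $B,\bar B$ (which may depend on $x,t$) such that $B$ commutes with $\mathcal D(k)$ and $\bar B$ with $\overline{\mathcal D}(k)$ for all $k$ off the poles. Let $\Gamma(k,x,t)$, $(x,t)\in\mathbb R^2$, be a family of soliton matrices with these zeros and blocks (that is, $\Gamma(\cdot,x,t)$ has $p$-vectors for each $(x,t)$), which satisfies $$\partial_x\Gamma=\Gamma\Lambda+U\Gamma,\qquad\partial_t\Gamma=\Gamma\Omega+V\Gamma$$ away from the points $\bar k_n$, with potentials $U(k,x,t),V(k,x,t)$ polynomial in $k$. **Theorem.** 1. *(Derived equations.)* All $p$-vectors of $\Gamma$ that are differentiable in $x$ and in $t$ satisfy $$\mathbf\Gamma_\nu(\kappa_\nu)\{[\partial_x+\mathbf\Lambda_\nu(\kappa_\nu)]\mathbf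 p_\nu\}=0,\qquad\mathbf\Gamma_\nu(\kappa_\nu)\{[\partial_t+\mathbf\Omega_\nu(\kappa_\nu)]\mathbf p_\nu\}=0,$$ $$\{\partial_x\bar{\mathbf p}_\nu-\bar{\mathbf p}_\nu\overline{\mathbf\Lambda}_\nu(\bar\kappa_\nu)\}\overline{\mathbf\Gamma}_\nu(\bar\kappa_\nu)=0,\qquad\{\partial_t\bar{\mathbf p}_\nu-\bar{\mathbf p}_\nu\overline{\mathbf\Omega}_\nu(\bar\kappa_\nu)\}\overline{\mathbf\Gamma}_\nu(\bar\kappa_\nu)=0 .$$ 2. *(Evolution.)* Vectors $\mathbf p_\nu(x,t),\bar{\mathbf p}_\nu(x,t)$ are differentiable in $x$ and in $t$ and make the expressions in braces all vanish, for all $\nu$, $x$, $t$, if and only if there are constant vectors, marked by the subscript $0$, with $$\mathbf p_\nu=\exp\{-\mathbf\Lambda_\nu(\kappa_\nu)x-\mathbf\Omega_\nu(\kappa_\nu)t\}\,\mathbf p_{0\nu},\qquad \bar{\mathbf p}_\nu=\bar{\mathbf p}_{0\nu}\exp\{\overline{\mathbf\Lambda}_\nu(\bar\kappa_\nu)x+\overline{\mathbf\Omega}_\nu(\bar\kappa_\nu)t\};\tag{$*$}$$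 this holds for the $|p\rangle$- and for the $\langle\bar p|$-vectors separately. 3. *(No loss of generality.)* Let $\mathbf p_{0\nu},\bar{\mathbf p}_{0\nu}$ be any $p$-vectors of $\Gamma(\cdot,0,0)$. Then the vectors $(*)$ are $p$-vectors of $\Gamma(\cdot,x,t)$ for all $(x,t)$, and any other $p$-vectors of $\Gamma(\cdot,x,t)$ arise from them by an invariance transformation. Moreover, let $\tilde{\mathbf p}_\nu(x,t),\bar{\tilde{\mathbf p}}_\nu(x,t)$ be any vectors, differentiable in $x$ and in $t$, that solve the derived equations in 1, satisfy $\mathbf\Gamma_\nu(\kappa_\nu)\tilde{\mathbf p}_\nu=0$ and $\bar{\tilde{\mathbf p}}_\nu\overline{\mathbf\Gamma}_\nu(\bar\kappa_\nu)=0$ at $(x,t)=(0,0)$, and whose matrices $\mathcal K,\overline{\mathcal K}$ are non-degenerate for all $(x,t)$. Then at each $(x,t)$ they arise from the vectors $(*)$ by an invariance transformation, and they are $p$-vectors of $\Gamma(\cdot,x,t)$, i.e. give the same soliton matrix. 4. *(The exponentials.)* $\exp\{-\mathbf\Lambda_\nu(\kappa_\nu)x-\mathbf\Omega_\nu(\kappa_\nu)t\}=\mathbf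 E_\nu(\kappa_\nu)$, the lower-triangular block-Toeplitz matrix formed from $E(k)$ at $k=\kappa_\nu$, and $\exp\{\overline{\mathbf\Lambda}_\nu(\bar\kappa_\nu)x+\overline{\mathbf\Omega}_\nu(\bar\kappa_\nu)t\}$ is the upper-triangular block-Toeplitz matrix formed from $E^{-1}(k)$ at $k=\bar\kappa_\nu$. -/

import Mathlib

open Polynomial

namespace Soliton

/-- The discrete spectrum of a soliton matrix with `NZ` pairs of normal zeros `(k n, kbar n)`:
`r n` is the geometric multiplicity of the `n`-th pair and `s n` its block sequence
`s n 0 ≥ s n 1 ≥ …` of positive integers. -/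
structure ZeroData where
  /-- number of pairs of zeros -/
  NZ : ℕ
  /-- zeros in the domain `C₊` -/
  k : Fin NZ → ℂ
  /-- zeros in the domain `C₋` -/
  kbar : Fin NZ → ℂ
  k_injective : Function.Injective k
  kbar_injective : Function.Injective kbar
  k_ne_kbar : ∀ m n, k m ≠ kbar n
  /-- geometric multiplicities -/
  r : Fin NZ → ℕ
  r_pos : ∀ n, 0 < r n
  /-- block sequences -/
  s : (n : Fin NZ) → Fin (r n) → ℕ
  s_pos : ∀ n ν, 0 < s n ν
  s_antitone : ∀ n, Antitone (s n)

/-- The value at `z` of a matrix whose entries are polynomials in the spectral parameter. -/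
noncomputable def evalM {N : ℕ} (A : Matrix (Fin N) (Fin N) ℂ[X]) (z : ℂ) :
    Matrix (Fin N) (Fin N) ℂ :=
  A.map (Polynomial.eval z)

/-- Lower-triangular block-Toeplitz matrix with `s × s` blocks: the block in position `(i, j)`,
`j ≤ i`, is the `(i - j)`-th derivative of `F` at `z` divided by `(i - j)!`. -/
noncomputable def lowerToeplitz {N : ℕ} (s : ℕ) (F : ℂ → Matrix (Fin N) (Fin N) ℂ) (z : ℂ) :
    Matrix (Fin s × Fin N) (Fin s × Fin N) ℂ :=
  Matrix.of fun i j =>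
    if j.1 ≤ i.1 then
      iteratedDeriv (i.1.val - j.1.val) (fun w => F w i.2 j.2) z
        / ((i.1.val - j.1.val).factorial : ℂ)
    else 0

/-- Upper-triangular block-Toeplitz matrix with `s × s` blocks: the block in position `(i, j)`,
`i ≤ j`, is the `(j - i)`-th derivative of `F` at `z` divided by `(j - i)!`. -/
noncomputable def upperToeplitz {N : ℕ} (s : ℕ) (F : ℂ → Matrix (Fin N) (Fin N) ℂ) (z : ℂ) :
    Matrix (Fin s × Fin N) (Fin s × Fin N) ℂ :=
  Matrix.of fun i j =>
    if i.1 ≤ j.1 then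
      iteratedDeriv (j.1.val - i.1.val) (fun w => F w i.2 j.2) z
        / ((j.1.val - i.1.val).factorial : ℂ)
    else 0

/-- `E(z) = exp(-Λ(z) x - Ω(z) t)`. -/
noncomputable def expE {N : ℕ} (lam om : Matrix (Fin N) (Fin N) ℂ[X]) (x t : ℝ) (z : ℂ) :
    Matrix (Fin N) (Fin N) ℂ :=
  NormedSpace.exp (-((x : ℂ) • evalM lam z) - (t : ℂ) • evalM om z)

/-- The Toeplitz basis matrices, `(H_j)_{αβ} = δ_{α, β - j}`. -/
def toeplitzH (s : ℕ) (j : ℤ) : Matrix (Fin s) (Fin s) ℂ :=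
  Matrix.of fun α β => if (α.val : ℤ) = (β.val : ℤ) - j then 1 else 0

namespace ZeroData

variable (D : ZeroData) {N : ℕ}

/-- The `ν`-blocks, of all pairs of zeros. -/
abbrev Block : Type := Σ n : Fin D.NZ, Fin (D.r n)

/-- The zero `κ_ν` to which the block `ν` belongs. -/
def κ (ν : D.Block) : ℂ := D.k ν.1

/-- The zero `κ̄_ν` to which the block `ν` belongs. -/
def κbar (ν : D.Block) : ℂ := D.kbar ν.1

/-- The size `s_ν` of the block `ν`. -/
abbrev size (ν : D.Block) : ℕ := D.s ν.1 ν.2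

/-- The indices `(ν, i)` of the `p`-vectors; `i` counts from `0`. -/
abbrev Idx : Type := Σ ν : D.Block, Fin (D.size ν)

/-- A system of vectors of length `N`, one for each index. It stands for the columns
`|p_i^{(ν)}⟩` as well as for the rows `⟨p̄_i^{(ν)}|`. -/
abbrev Vecs (N : ℕ) : Type := D.Idx → Fin N → ℂ

variable {D}

/-- The matrix whose columns are the vectors `p`. -/
def cols (p : D.Vecs N) : Matrix (Fin N) D.Idx ℂ := Matrix.of fun a i => p i a

/-- The matrix whose rows are the vectors `pbar`. -/
def rows (pbar : D.Vecs N) : Matrix D.Idx (Fin N) ℂ := Matrix.of fun i a => pbar i a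

/-- The vectors of the block `ν`, stacked into one vector of length `s_ν N`. -/
def stack (ν : D.Block) (p : D.Vecs N) : Fin (D.size ν) × Fin N → ℂ := fun j => p ⟨ν, j.1⟩ j.2

variable (D)

/-- The block-diagonal matrix of the upper-triangular Toeplitz matrices `D_ν(z)`. -/
noncomputable def poleD (z : ℂ) : Matrix D.Idx D.Idx ℂ :=
  Matrix.blockDiagonal' fun ν : D.Block =>
    Matrix.of fun α β : Fin (D.size ν) =>
      if α ≤ β then 1 / (z - D.κ ν) ^ (β.val - α.val + 1) else 0

/-- The block-diagonal matrix of the lower-triangular Toeplitz matrices `D̄_ν(z)`. -/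
noncomputable def poleDbar (z : ℂ) : Matrix D.Idx D.Idx ℂ :=
  Matrix.blockDiagonal' fun ν : D.Block =>
    Matrix.of fun α β : Fin (D.size ν) =>
      if β ≤ α then 1 / (z - D.κbar ν) ^ (α.val - β.val + 1) else 0

variable {D}

/-- The matrix `Q̄_l^{(ν,μ)}`: the products `⟨p̄_α^{(ν)}|p_β^{(μ)}⟩`, shifted by `l` columns to the
right. -/
def innerQbar (p pbar : D.Vecs N) (ν μ : D.Block) (l : ℕ) :
    Matrix (Fin (D.size ν)) (Fin (D.size μ)) ℂ :=
  Matrix.of fun α β =>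
    if l ≤ β.val then
      pbar ⟨ν, α⟩ ⬝ᵥ p ⟨μ, ⟨β.val - l, lt_of_le_of_lt (Nat.sub_le _ _) β.isLt⟩⟩
    else 0

/-- The matrix `Q_l^{(ν,μ)}`: the products `⟨p̄_α^{(ν)}|p_β^{(μ)}⟩`, shifted by `l` rows down. -/
def innerQ (p pbar : D.Vecs N) (ν μ : D.Block) (l : ℕ) :
    Matrix (Fin (D.size ν)) (Fin (D.size μ)) ℂ :=
  Matrix.of fun α β =>
    if l ≤ α.val then
      pbar ⟨ν, ⟨α.val - l, lt_of_le_of_lt (Nat.sub_le _ _) α.isLt⟩⟩ ⬝ᵥ p ⟨μ, β⟩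
    else 0

/-- The block `K̄^{(ν,μ)}`. -/
noncomputable def blockKbar (p pbar : D.Vecs N) (ν μ : D.Block) :
    Matrix (Fin (D.size ν)) (Fin (D.size μ)) ℂ :=
  ∑ j ∈ Finset.range (D.size ν), ∑ l ∈ Finset.range (D.size μ),
    ((-1 : ℂ) ^ l * ((j + l).factorial : ℂ) / ((j.factorial : ℂ) * (l.factorial : ℂ))
        / (D.κ μ - D.κbar ν) ^ (j + l + 1)) •
      (toeplitzH (D.size ν) (-(j : ℤ)) * innerQbar p pbar ν μ l)

/-- The block `K^{(ν,μ)}`. -/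
noncomputable def blockK (p pbar : D.Vecs N) (ν μ : D.Block) :
    Matrix (Fin (D.size ν)) (Fin (D.size μ)) ℂ :=
  ∑ l ∈ Finset.range (D.size ν), ∑ j ∈ Finset.range (D.size μ),
    ((-1 : ℂ) ^ l * ((l + j).factorial : ℂ) / ((l.factorial : ℂ) * (j.factorial : ℂ))
        / (D.κbar ν - D.κ μ) ^ (l + j + 1)) •
      (innerQ p pbar ν μ l * toeplitzH (D.size μ) (j : ℤ))

/-- The matrix `K̄` with the blocks `K̄^{(ν,μ)}`. -/
noncomputable def matKbar (p pbar : D.Vecs N) : Matrix D.Idx D.Idx ℂ :=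
  Matrix.of fun i j => blockKbar p pbar i.1 j.1 i.2 j.2

/-- The matrix `K` with the blocks `K^{(ν,μ)}`. -/
noncomputable def matK (p pbar : D.Vecs N) : Matrix D.Idx D.Idx ℂ :=
  Matrix.of fun i j => blockK p pbar i.1 j.1 i.2 j.2

/-- `p` and `pbar` are `p`-vectors of the soliton matrix `G` with inverse `Ginv`: the matrices
`K̄`, `K` are non-degenerate, and
`G(z) = I - (p) K̄⁻¹ D̄(z) (p̄)`, `Ginv(z) = I - (p) D(z) K⁻¹ (p̄)` away from the poles. -/
structure IsPVectors (G Ginv : ℂ → Matrix (Fin N) (Fin N) ℂ) (p pbar : D.Vecs N) : Prop where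
  isUnit_Kbar : IsUnit (matKbar p pbar).det
  isUnit_K : IsUnit (matK p pbar).det
  eq_soliton : ∀ z, z ∉ Set.range D.kbar →
    G z = 1 - cols p * (matKbar p pbar)⁻¹ * D.poleDbar z * rows pbar
  eq_inverse : ∀ z, z ∉ Set.range D.k →
    Ginv z = 1 - cols p * D.poleD z * (matK p pbar)⁻¹ * rows pbar

/-- The linear system `𝚪_ν(κ_ν) (p_1; …; p_s) = 0`, for all blocks. -/
def KernelEq (G : ℂ → Matrix (Fin N) (Fin N) ℂ) (p : D.Vecs N) : Prop :=
  ∀ ν : D.Block, (lowerToeplitz (D.size ν) G (D.κ ν)).mulVec (stack ν p) = 0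

/-- The linear system `(p̄_1, …, p̄_s) 𝚪̄_ν(κ̄_ν) = 0`, for all blocks. -/
def KernelEqBar (Ginv : ℂ → Matrix (Fin N) (Fin N) ℂ) (pbar : D.Vecs N) : Prop :=
  ∀ ν : D.Block, Matrix.vecMul (stack ν pbar) (upperToeplitz (D.size ν) Ginv (D.κbar ν)) = 0

variable (D) in
/-- Invariance matrices acting on the `p`-vectors: non-degenerate and commuting with `D(z)`. -/
def IsInvariance (B : Matrix D.Idx D.Idx ℂ) : Prop :=
  IsUnit B.det ∧ ∀ z, z ∉ Set.range D.k → B * D.poleD z = D.poleD z * B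

variable (D) in
/-- Invariance matrices acting on the `p̄`-vectors: non-degenerate and commuting with `D̄(z)`. -/
def IsInvarianceBar (B : Matrix D.Idx D.Idx ℂ) : Prop :=
  IsUnit B.det ∧ ∀ z, z ∉ Set.range D.kbar → B * D.poleDbar z = D.poleDbar z * B

/-- `p̃ = p B` and `p̄̃ = B̄ p̄` with invariance matrices `B` and `B̄`. -/
def InvarianceRelated (p pbar p' pbar' : D.Vecs N) : Prop :=
  ∃ B Bbar : Matrix D.Idx D.Idx ℂ, D.IsInvariance B ∧ D.IsInvarianceBar Bbar ∧
    cols p' = cols p * B ∧ rows pbar' = Bbar * rows pbar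

/-- All components are differentiable in `x` and in `t`. -/
def PartialDiff (p : ℝ → ℝ → D.Vecs N) : Prop :=
  ∀ x t i a, DifferentiableAt ℝ (fun y => p y t i a) x ∧
    DifferentiableAt ℝ (fun τ => p x τ i a) t

/-- `∂_x p`. -/
noncomputable def dx (p : ℝ → ℝ → D.Vecs N) (x t : ℝ) : D.Vecs N :=
  fun i a => deriv (fun y => p y t i a) x

/-- `∂_t p`. -/
noncomputable def dt (p : ℝ → ℝ → D.Vecs N) (x t : ℝ) : D.Vecs N :=
  fun i a => deriv (fun τ => p x τ i a) t

/-- `[∂ + 𝐀_ν(κ_ν)] (p_1; …; p_s)`, where `dp` is the derivative `∂ p`. -/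
noncomputable def bracket (A : Matrix (Fin N) (Fin N) ℂ[X]) (dp p : D.Vecs N) (ν : D.Block) :
    Fin (D.size ν) × Fin N → ℂ :=
  stack ν dp + (lowerToeplitz (D.size ν) (evalM A) (D.κ ν)).mulVec (stack ν p)

/-- `∂ (p̄_1, …, p̄_s) - (p̄_1, …, p̄_s) 𝐀̄_ν(κ̄_ν)`, where `dp` is the derivative `∂ p̄`. -/
noncomputable def bracketBar (A : Matrix (Fin N) (Fin N) ℂ[X]) (dp pbar : D.Vecs N)
    (ν : D.Block) : Fin (D.size ν) × Fin N → ℂ :=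
  stack ν dp - Matrix.vecMul (stack ν pbar) (upperToeplitz (D.size ν) (evalM A) (D.κbar ν))

/-- The derived equations
`𝚪_ν(κ_ν) {[∂_x + 𝚲_ν(κ_ν)] p} = 0` and `𝚪_ν(κ_ν) {[∂_t + 𝛀_ν(κ_ν)] p} = 0`. -/
def DerivedEq (lam om : Matrix (Fin N) (Fin N) ℂ[X]) (G : ℝ → ℝ → ℂ → Matrix (Fin N) (Fin N) ℂ)
    (p : ℝ → ℝ → D.Vecs N) : Prop :=
  ∀ x t (ν : D.Block),
    (lowerToeplitz (D.size ν) (G x t) (D.κ ν)).mulVec (bracket lam (dx p x t) (p x t) ν) = 0 ∧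
    (lowerToeplitz (D.size ν) (G x t) (D.κ ν)).mulVec (bracket om (dt p x t) (p x t) ν) = 0

/-- The derived equations
`{∂_x p̄ - p̄ 𝚲̄_ν(κ̄_ν)} 𝚪̄_ν(κ̄_ν) = 0` and `{∂_t p̄ - p̄ 𝛀̄_ν(κ̄_ν)} 𝚪̄_ν(κ̄_ν) = 0`. -/
def DerivedEqBar (lam om : Matrix (Fin N) (Fin N) ℂ[X])
    (Ginv : ℝ → ℝ → ℂ → Matrix (Fin N) (Fin N) ℂ) (pbar : ℝ → ℝ → D.Vecs N) : Prop :=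
  ∀ x t (ν : D.Block),
    Matrix.vecMul (bracketBar lam (dx pbar x t) (pbar x t) ν)
      (upperToeplitz (D.size ν) (Ginv x t) (D.κbar ν)) = 0 ∧
    Matrix.vecMul (bracketBar om (dt pbar x t) (pbar x t) ν)
      (upperToeplitz (D.size ν) (Ginv x t) (D.κbar ν)) = 0

/-- The evolution equations `[∂_x + 𝚲_ν(κ_ν)] p = 0`, `[∂_t + 𝛀_ν(κ_ν)] p = 0`. -/
def EvolutionEq (lam om : Matrix (Fin N) (Fin N) ℂ[X]) (p : ℝ → ℝ → D.Vecs N) : Prop :=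
  ∀ x t (ν : D.Block),
    bracket lam (dx p x t) (p x t) ν = 0 ∧ bracket om (dt p x t) (p x t) ν = 0

/-- The evolution equations `∂_x p̄ = p̄ 𝚲̄_ν(κ̄_ν)`, `∂_t p̄ = p̄ 𝛀̄_ν(κ̄_ν)`. -/
def EvolutionEqBar (lam om : Matrix (Fin N) (Fin N) ℂ[X]) (pbar : ℝ → ℝ → D.Vecs N) : Prop :=
  ∀ x t (ν : D.Block),
    bracketBar lam (dx pbar x t) (pbar x t) ν = 0 ∧ bracketBar om (dt pbar x t) (pbar x t) ν = 0

/-- `exp(-𝚲_ν(κ_ν) x - 𝛀_ν(κ_ν) t)`. -/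
noncomputable def propagator (lam om : Matrix (Fin N) (Fin N) ℂ[X]) (x t : ℝ) (ν : D.Block) :
    Matrix (Fin (D.size ν) × Fin N) (Fin (D.size ν) × Fin N) ℂ :=
  NormedSpace.exp (-((x : ℂ) • lowerToeplitz (D.size ν) (evalM lam) (D.κ ν))
    - (t : ℂ) • lowerToeplitz (D.size ν) (evalM om) (D.κ ν))

/-- `exp(𝚲̄_ν(κ̄_ν) x + 𝛀̄_ν(κ̄_ν) t)`. -/
noncomputable def propagatorBar (lam om : Matrix (Fin N) (Fin N) ℂ[X]) (x t : ℝ) (ν : D.Block) :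
    Matrix (Fin (D.size ν) × Fin N) (Fin (D.size ν) × Fin N) ℂ :=
  NormedSpace.exp ((x : ℂ) • upperToeplitz (D.size ν) (evalM lam) (D.κbar ν)
    + (t : ℂ) • upperToeplitz (D.size ν) (evalM om) (D.κbar ν))

/-- The vectors `exp(-𝚲_ν(κ_ν) x - 𝛀_ν(κ_ν) t) (p_01; …; p_0s)`, for all blocks. -/
noncomputable def evolve (lam om : Matrix (Fin N) (Fin N) ℂ[X]) (p0 : D.Vecs N) (x t : ℝ) :
    D.Vecs N :=
  fun i a => (propagator lam om x t i.1).mulVec (stack i.1 p0) (i.2, a)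

/-- The vectors `(p̄_01, …, p̄_0s) exp(𝚲̄_ν(κ̄_ν) x + 𝛀̄_ν(κ̄_ν) t)`, for all blocks. -/
noncomputable def evolveBar (lam om : Matrix (Fin N) (Fin N) ℂ[X]) (pbar0 : D.Vecs N) (x t : ℝ) :
    D.Vecs N :=
  fun i a => Matrix.vecMul (stack i.1 pbar0) (propagatorBar lam om x t i.1) (i.2, a)

end ZeroData

end Soliton

/-! Let `A` and `Ā` be the block-diagonal matrices of Jordan blocks (transposed for `Ā`) with `D(k)
= (k - A)⁻¹` and `D̄(k) = (k - Ā)⁻¹`. Then `Γ = I - P K̄⁻¹ (k - Ā)⁻¹ P̄`, and `K̄` is the solution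
of the Sylvester equation `K̄ A - Ā K̄ = P̄ P` (`matKbar_sylvester`), unique because `A` and `Ā`
have no common eigenvalue. Multiplication by `det(k - Ā)` turns `Γ` into a monic matrix polynomial
`F`.

For `F = ∑ F_k X^k` put `F·Q = ∑ F_k Q A^k` (`polyAct`). A polynomial of a Jordan block has Taylor
coefficients as entries, so the systems `𝚪_ν(κ_ν) q_ν = 0` for all `ν` together say `F·Q = 0`. The
solutions are exactly `Q = P B` with `B` commuting with `A` (`polyAct_solitonPoly_eq_zero_iff`), and
`Q` determines `B` (`eq_zero_of_mul_eq_zero`).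

The linear problem for `Γ` passes to `F`, whence `(F·Q)' = F·(Q' + Λ·Q) + U·(F·Q)`. If `F·Q`
vanishes identically, this is the derived equation. Conversely, under the derived equation `F·Q`
solves a linear ODE, and its vanishing at one point propagates; the coefficients are continuous
because `F` is monic, so that `U` can be recovered from `F`. The exponentials satisfy `Q' + Λ·Q =
0`, so vectors starting in the kernel stay there and are `P B`; running the flow backwards shows
that `B` is invertible. Finally `K̄` becomes `B̄ K̄ B`, so invariance transformations preserve `Γ`,
and non-degeneracy of the new `K̄` forces `B` and `B̄` to be invertible.

The statements on `⟨p̄|` are those on `|p⟩` for `(Γ⁻¹)ᵀ`, with the zeros of each pair exchanged and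
`Λ, Ω, U, V` replaced by their negative transposes (`dual`). -/

namespace Soliton

open Matrix
open scoped Topology

/-! ### Matrix polynomials acting on matrices, and the kernel of a soliton matrix -/

section PolyAct

variable {l m n ι : Type*} [Fintype n] [Fintype ι] [DecidableEq ι]

/-- The value of the matrix polynomial `F = ∑ F_k X^k` on `P`, with `A` substituted for the
variable from the right: `∑ F_k P A^k`. -/
noncomputable def polyAct (A : Matrix ι ι ℂ) (F : Matrix m n ℂ[X]) (P : Matrix n ι ℂ) :
    Matrix m ι ℂ :=
  Matrix.of fun a i => ∑ b, ∑ j, P b j * aeval A (F a b) j i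

variable (A : Matrix ι ι ℂ)

theorem polyAct_apply (F : Matrix m n ℂ[X]) (P : Matrix n ι ℂ) (a : m) (i : ι) :
    polyAct A F P a i = ∑ b, ∑ j, P b j * aeval A (F a b) j i := rfl

theorem polyAct_row (F : Matrix m n ℂ[X]) (P : Matrix n ι ℂ) (a : m) :
    polyAct A F P a = ∑ b, P b ᵥ* aeval A (F a b) := by
  ext i
  simp [polyAct_apply, Matrix.vecMul, dotProduct]

/-- Coefficients multiply from the left and the variable acts from the right, so the two actions do
not interfere: this is a module structure although the coefficients do not commute. -/
theorem polyAct_mul [Fintype m] (F : Matrix l m ℂ[X]) (G : Matrix m n ℂ[X]) (P : Matrix n ι ℂ) :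
    polyAct A (F * G) P = polyAct A F (polyAct A G P) := by
  funext a
  rw [polyAct_row, polyAct_row]
  simp_rw [polyAct_row, Matrix.mul_apply, map_sum, map_mul, Matrix.vecMul_sum]
  rw [Finset.sum_comm]
  refine Finset.sum_congr rfl fun b _ => ?_
  rw [Matrix.sum_vecMul]
  refine Finset.sum_congr rfl fun c _ => ?_
  rw [Matrix.vecMul_vecMul, ← map_mul, ← map_mul, mul_comm]

theorem polyAct_add_left (F G : Matrix m n ℂ[X]) (P : Matrix n ι ℂ) :
    polyAct A (F + G) P = polyAct A F P + polyAct A G P := by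
  ext a i
  simp [polyAct_apply, mul_add, Finset.sum_add_distrib]

theorem polyAct_sub_left (F G : Matrix m n ℂ[X]) (P : Matrix n ι ℂ) :
    polyAct A (F - G) P = polyAct A F P - polyAct A G P := by
  ext a i
  simp [polyAct_apply, mul_sub, Finset.sum_sub_distrib]

theorem polyAct_add_right (F : Matrix m n ℂ[X]) (P Q : Matrix n ι ℂ) :
    polyAct A F (P + Q) = polyAct A F P + polyAct A F Q := by
  ext a i
  simp [polyAct_apply, add_mul, Finset.sum_add_distrib]

theorem polyAct_zero_right (F : Matrix m n ℂ[X]) : polyAct A F (0 : Matrix n ι ℂ) = 0 := by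
  ext a i
  simp [polyAct_apply]

theorem polyAct_map_C (R : Matrix m n ℂ) (P : Matrix n ι ℂ) :
    polyAct A (R.map C) P = R * P := by
  ext a i
  simp [polyAct_apply, Matrix.mul_apply, Matrix.algebraMap_matrix_apply, mul_comm]

theorem polyAct_smul_one [DecidableEq n] (q : ℂ[X]) (P : Matrix n ι ℂ) :
    polyAct A (q • (1 : Matrix n n ℂ[X])) P = P * aeval A q := by
  funext a
  rw [polyAct_row, Finset.sum_eq_single a]
  · ext i; simp [Matrix.mul_apply, Matrix.vecMul, dotProduct]
  · intro b _ hb; simp [Matrix.one_apply_ne hb.symm]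
  · simp

/-- Matrices intertwining `A` and `A'` intertwine polynomials in them. -/
theorem intertwine_aeval {A A' Y : Matrix ι ι ℂ} (h : Y * A = A' * Y) (q : ℂ[X]) :
    Y * aeval A q = aeval A' q * Y := by
  induction q using Polynomial.induction_on with
  | C a => simp [Algebra.commutes]
  | add p q hp hq => simp [mul_add, add_mul, hp, hq]
  | monomial n a hn =>
    rw [pow_succ, ← mul_assoc, map_mul (aeval A), map_mul (aeval A') _ X, ← mul_assoc, hn, aeval_X,
      aeval_X, mul_assoc, h, mul_assoc]

theorem polyAct_mul_right {A : Matrix ι ι ℂ} {B : Matrix ι ι ℂ} (h : Commute A B)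
    (F : Matrix m n ℂ[X]) (P : Matrix n ι ℂ) : polyAct A F (P * B) = polyAct A F P * B := by
  funext a
  have hrow : polyAct A F P a ᵥ* B = (polyAct A F P * B) a := rfl
  rw [← hrow, polyAct_row, polyAct_row, Matrix.sum_vecMul]
  refine Finset.sum_congr rfl fun b _ => ?_
  have hrow' : (P * B) b = P b ᵥ* B := rfl
  rw [hrow', Matrix.vecMul_vecMul, Matrix.vecMul_vecMul, intertwine_aeval h.symm.eq]

/-- A Bézout identity for the two characteristic polynomials, evaluated at `A`, loses one term by
Cayley–Hamilton. -/
theorem isUnit_aeval_charpoly {A A' : Matrix ι ι ℂ} (h : IsCoprime A.charpoly A'.charpoly) :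
    IsUnit (aeval A A'.charpoly) := by
  obtain ⟨a, b, hab⟩ := h
  have := congrArg (aeval A) hab
  rw [map_add, map_mul, map_mul, Matrix.aeval_self_charpoly, mul_zero, zero_add, map_one] at this
  exact IsUnit.of_mul_eq_one_right _ this

/-- Uniqueness for the Sylvester equation. -/
theorem eq_zero_of_intertwine {A A' Y : Matrix ι ι ℂ} (hc : IsCoprime A.charpoly A'.charpoly)
    (h : Y * A = A' * Y) : Y = 0 := by
  have h1 := intertwine_aeval h A'.charpoly
  rw [Matrix.aeval_self_charpoly, zero_mul] at h1
  exact (isUnit_aeval_charpoly hc).mul_left_eq_zero.1 h1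

/-- `det(X - A') (1 - P M⁻¹ (X - A')⁻¹ P')`, as a matrix polynomial. -/
noncomputable def solitonPoly [DecidableEq n] (A' M : Matrix ι ι ℂ) (P : Matrix n ι ℂ)
    (P' : Matrix ι n ℂ) : Matrix n n ℂ[X] :=
  A'.charpoly • 1 - (P * M⁻¹).map C * (adjugate (charmatrix A') * P'.map C)

/-- The Sylvester operator is the action of `X - A'`; multiplying by the adjugate therefore reduces
it to right multiplication by the invertible matrix `χ_{A'}(A)`. -/
theorem polyAct_charmatrix (A' Y : Matrix ι ι ℂ) :
    polyAct A (charmatrix A') Y = Y * A - A' * Y := by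
  have : charmatrix A' = (X : ℂ[X]) • (1 : Matrix ι ι ℂ[X]) - A'.map C := by
    rw [charmatrix, Matrix.scalar_apply, Matrix.smul_one_eq_diagonal]; rfl
  rw [this, polyAct_sub_left, polyAct_smul_one, polyAct_map_C, aeval_X]

theorem polyAct_solitonPoly [DecidableEq n] (A' M : Matrix ι ι ℂ) (P : Matrix n ι ℂ)
    (P' : Matrix ι n ℂ) (Q : Matrix n ι ℂ) :
    polyAct A (solitonPoly A' M P P') Q =
      Q * aeval A A'.charpoly - P * M⁻¹ * polyAct A (adjugate (charmatrix A')) (P' * Q) := by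
  rw [solitonPoly, polyAct_sub_left, polyAct_smul_one, polyAct_mul, polyAct_mul, polyAct_map_C,
    polyAct_map_C]

/-- The kernel of a soliton matrix consists of the invariance transforms of its `p`-vectors. -/
theorem polyAct_solitonPoly_eq_zero_iff [DecidableEq n] {A A' M : Matrix ι ι ℂ}
    {P : Matrix n ι ℂ} {P' : Matrix ι n ℂ} (hc : IsCoprime A.charpoly A'.charpoly)
    (hM : IsUnit M.det) (hS : M * A - A' * M = P' * P) (Q : Matrix n ι ℂ) :
    polyAct A (solitonPoly A' M P P') Q = 0 ↔ ∃ B, Commute A B ∧ Q = P * B := by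
  have hu := isUnit_aeval_charpoly hc
  constructor
  · intro h
    rw [polyAct_solitonPoly, sub_eq_zero] at h
    set Z := polyAct A (adjugate (charmatrix A')) (P' * Q) with hZ
    have h1 : Z * A - A' * Z = P' * Q * aeval A A'.charpoly := by
      rw [← polyAct_charmatrix, hZ, ← polyAct_mul, Matrix.mul_adjugate, polyAct_smul_one]; rfl
    rw [Matrix.mul_assoc, h, ← Matrix.mul_assoc, ← Matrix.mul_assoc, ← hS] at h1
    have hMM : M * M⁻¹ = 1 := Matrix.mul_nonsing_inv _ hM
    have hMM' : M⁻¹ * M = 1 := Matrix.nonsing_inv_mul _ hM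
    have h2 : Z * A = M * A * M⁻¹ * Z := by
      have : (M * A - A' * M) * M⁻¹ * Z = M * A * M⁻¹ * Z - A' * Z := by
        rw [sub_mul, sub_mul, mul_assoc A', hMM, mul_one]
      rw [this] at h1
      simpa using h1
    obtain ⟨u, hu⟩ := hu
    have hAu : Commute A (↑u⁻¹ : Matrix ι ι ℂ) := by
      have : Commute A (u : Matrix ι ι ℂ) := by
        rw [hu]; have := intertwine_aeval (rfl : A * A = A * A) A'.charpoly
        exact this
      exact this.units_inv_right
    refine ⟨M⁻¹ * Z * (↑u⁻¹ : Matrix ι ι ℂ), ?_, ?_⟩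
    · refine Commute.mul_right ?_ hAu
      change A * (M⁻¹ * Z) = M⁻¹ * Z * A
      rw [mul_assoc, h2, mul_assoc, mul_assoc, ← mul_assoc, ← mul_assoc M⁻¹ M, hMM', one_mul,
        mul_assoc]
    · rw [← Matrix.mul_assoc, ← Matrix.mul_assoc, ← h, ← hu, Matrix.mul_assoc]
      simp
  · rintro ⟨B, hB, rfl⟩
    -- As `P' P` is `X - A'` acting on `M`, the adjugate turns it into `M χ_{A'}(A)`, and `M⁻¹ M`
    -- cancels.
    rw [polyAct_mul_right hB, polyAct_solitonPoly, ← hS, ← polyAct_charmatrix, ← polyAct_mul,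
      Matrix.adjugate_mul]
    rw [show (charmatrix A').det = A'.charpoly from rfl, polyAct_smul_one, ← Matrix.mul_assoc,
      Matrix.mul_assoc P, Matrix.nonsing_inv_mul _ hM, Matrix.mul_one, sub_self, Matrix.zero_mul]

/-- Invariance transformations act freely on the `p`-vectors. -/
theorem eq_zero_of_mul_eq_zero {A A' M : Matrix ι ι ℂ}
    {P : Matrix n ι ℂ} {P' : Matrix ι n ℂ} (hc : IsCoprime A.charpoly A'.charpoly)
    (hM : IsUnit M.det) (hS : M * A - A' * M = P' * P) {B : Matrix ι ι ℂ} (hB : Commute A B)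
    (h : P * B = 0) : B = 0 := by
  -- `M B` intertwines two matrices with coprime characteristic polynomials, so it vanishes.
  have h1 : M * B * A = A' * (M * B) := by
    have : (M * A - A' * M) * B = 0 := by rw [hS, Matrix.mul_assoc, h, Matrix.mul_zero]
    rw [sub_mul, sub_eq_zero] at this
    rw [mul_assoc, ← hB.eq, ← mul_assoc, this, mul_assoc]
  have h2 := eq_zero_of_intertwine hc h1
  rw [← Matrix.one_mul B, ← Matrix.nonsing_inv_mul _ hM, Matrix.mul_assoc, h2, Matrix.mul_zero]

end PolyAct

/-! ### Uniqueness for linear ODEs -/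

section LinearODE

/-- A solution of a linear system with continuous coefficients that vanishes once vanishes after
that. -/
theorem linearODE_eq_zero_right {ι : Type*} [Fintype ι] {y : ℝ → ι → ℂ}
    {T : ℝ → Matrix ι ι ℂ} (hT : ∀ i j, Continuous fun x => T x i j)
    (hy : ∀ x i, HasDerivAt (fun s => y s i) ((T x *ᵥ y x) i) x) {x₀ : ℝ} (h₀ : y x₀ = 0)
    {x : ℝ} (hx : x₀ ≤ x) : y x = 0 := by
  have hyd : ∀ x, HasDerivAt y (T x *ᵥ y x) x := fun x => hasDerivAt_pi.2 (hy x)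
  -- The sum of the norms of all entries dominates the operator norm for the sup norm; a bound for
  -- it on `[x₀, x]` serves as the Grönwall constant.
  have hC : Continuous fun s => ∑ i, ∑ j, ‖T s i j‖ := by fun_prop
  obtain ⟨K, hK⟩ := (isCompact_Icc (a := x₀) (b := x)).bddAbove_image hC.continuousOn
  refine eq_zero_of_abs_deriv_le_mul_abs_self_of_eq_zero_right (f' := fun s => T s *ᵥ y s) (K := K)
    (fun s _ => (hyd s).continuousAt.continuousWithinAt)
    (fun s _ => (hyd s).hasDerivWithinAt) h₀ (fun s hs => ?_) x ⟨hx, le_rfl⟩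
  have hKs : ∑ i, ∑ j, ‖T s i j‖ ≤ K := hK ⟨s, ⟨hs.1, hs.2.le⟩, rfl⟩
  refine le_trans ?_ (mul_le_mul_of_nonneg_right hKs (norm_nonneg _))
  refine (pi_norm_le_iff_of_nonneg (by positivity)).2 fun i => ?_
  calc ‖(T s *ᵥ y s) i‖ ≤ ∑ j, ‖T s i j * y s j‖ := norm_sum_le _ _
    _ ≤ ∑ j, ‖T s i j‖ * ‖y s‖ := by
        gcongr with j
        rw [norm_mul]
        gcongr
        exact norm_le_pi_norm _ _
    _ = (∑ j, ‖T s i j‖) * ‖y s‖ := by rw [Finset.sum_mul]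
    _ ≤ (∑ i, ∑ j, ‖T s i j‖) * ‖y s‖ := by
        refine mul_le_mul_of_nonneg_right ?_ (norm_nonneg _)
        exact Finset.single_le_sum (f := fun i => ∑ j, ‖T s i j‖)
          (fun i _ => by positivity) (Finset.mem_univ i)

/-- A solution of a linear system with continuous coefficients that vanishes once vanishes. -/
theorem linearODE_eq_zero {ι : Type*} [Fintype ι] {y : ℝ → ι → ℂ}
    {T : ℝ → Matrix ι ι ℂ} (hT : ∀ i j, Continuous fun x => T x i j)
    (hy : ∀ x i, HasDerivAt (fun s => y s i) ((T x *ᵥ y x) i) x) {x₀ : ℝ} (h₀ : y x₀ = 0)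
    (x : ℝ) : y x = 0 := by
  rcases le_total x₀ x with h | h
  · exact linearODE_eq_zero_right hT hy h₀ h
  -- Points to the left of `x₀` are reached by reversing time.
  · have := linearODE_eq_zero_right (y := fun s => y (-s)) (T := fun s => -T (-s)) (x₀ := -x₀)
      (x := -x) (fun i j => ((hT i j).comp continuous_neg).neg)
      (fun s i => by
        have := (hy (-s) i).scomp s (hasDerivAt_neg s)
        simpa [Function.comp_def, Matrix.neg_mulVec] using this) (by simpa using h₀)
      (neg_le_neg h)
    simpa using this

end LinearODE

/-! ### Families of monic matrix polynomials with `F' = F Λ + U F` -/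

section PolynomialFamilies

/-- Polynomials of bounded degree that are differentiable at infinitely many points have
differentiable coefficients. -/
theorem hasDerivAt_coeff {f : ℝ → ℂ[X]} {g : ℂ[X]} {x : ℝ} {d : ℕ}
    (hd : ∀ y, (f y).natDegree ≤ d) {S : Set ℂ} (hS : S.Infinite)
    (h : ∀ z ∈ S, HasDerivAt (fun y => (f y).eval z) (g.eval z) x) (k : ℕ) :
    HasDerivAt (fun y => (f y).coeff k) (g.coeff k) x := by
  -- Enough nodes to interpolate every `f y` and also `g`: each coefficient is then one fixed linear
  -- combination of the values at the nodes.
  obtain ⟨t, htS, hcard⟩ := hS.exists_subset_card_eq (max d g.natDegree + 1)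
  have key : ∀ p : ℂ[X], p.natDegree < t.card →
      p.coeff k = ∑ i ∈ t, p.eval i * (Lagrange.basis t id i).coeff k := by
    intro p hp
    have h1 := Lagrange.eq_interpolate (s := t) (v := id) (f := p)
      (Set.injOn_id _) (degree_le_natDegree.trans_lt (by exact_mod_cast hp))
    conv_lhs => rw [h1, Lagrange.interpolate_apply, finsetSum_coeff]
    simp
  rw [key g (by omega)]
  have : (fun y => (f y).coeff k) =
      fun y => ∑ i ∈ t, (f y).eval i * (Lagrange.basis t id i).coeff k := by
    funext y
    exact key _ (by have := hd y; omega)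
  rw [this]
  exact HasDerivAt.fun_sum fun i hi => (h i (htS hi)).mul_const _

variable {n ι : Type*} [Fintype n] [Fintype ι] [DecidableEq ι]

theorem hasDerivAt_aeval {f : ℝ → ℂ[X]} {g : ℂ[X]} {x : ℝ} {d : ℕ}
    (hd : ∀ y, (f y).natDegree ≤ d)
    (h : ∀ k, HasDerivAt (fun y => (f y).coeff k) (g.coeff k) x) (A : Matrix ι ι ℂ) (i j : ι) :
    HasDerivAt (fun y => aeval A (f y) i j) (aeval A g i j) x := by
  have key : ∀ p : ℂ[X], p.natDegree < max d g.natDegree + 1 → aeval A p i j =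
      ∑ k ∈ Finset.range (max d g.natDegree + 1), p.coeff k * (A ^ k) i j := by
    intro p hp
    rw [aeval_eq_sum_range' hp, Matrix.sum_apply]
    simp
  rw [key g (by omega)]
  have : (fun y => aeval A (f y) i j) = _ :=
    funext fun y => key (f y) (by have := hd y; omega)
  rw [this]
  exact HasDerivAt.fun_sum fun k _ => (h k).mul_const _

theorem continuous_aeval {f : ℝ → ℂ[X]} {d : ℕ} (hd : ∀ y, (f y).natDegree ≤ d)
    (h : ∀ k, Continuous fun y => (f y).coeff k) (A : Matrix ι ι ℂ) (i j : ι) :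
    Continuous fun y => aeval A (f y) i j := by
  have : (fun y => aeval A (f y) i j) =
      fun y => ∑ k ∈ Finset.range (d + 1), (f y).coeff k * (A ^ k) i j := by
    funext y
    rw [aeval_eq_sum_range' (Nat.lt_succ_of_le (hd y)), Matrix.sum_apply]
    simp
  rw [this]
  exact continuous_finsetSum _ fun k _ => (h k).mul continuous_const

variable [DecidableEq n]

/-- A family of monic matrix polynomials `F` of degree `d` with `F' = F lam + U F`, where `U` is
a polynomial. -/
structure IsLaxFamily (d : ℕ) (lam : Matrix n n ℂ[X]) (F U : ℝ → Matrix n n ℂ[X]) : Prop where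
  natDegree_le : ∀ x a b, (F x a b).natDegree ≤ d
  coeff_top : ∀ x a b, (F x a b).coeff d = (1 : Matrix n n ℂ) a b
  hasDerivAt : ∀ x a b k, HasDerivAt (fun y => (F y a b).coeff k)
    (((F x * lam + U x * F x) a b).coeff k) x

namespace IsLaxFamily

variable {d : ℕ} {lam : Matrix n n ℂ[X]} {F U : ℝ → Matrix n n ℂ[X]}

/-- In degrees `≥ d` the coefficients of `F` are constant in `x`, namely `0` or those of the
identity, so the right-hand side of the equation has no such coefficients. -/
theorem coeff_mul_eq (h : IsLaxFamily d lam F U) (x : ℝ) (a b : n) (k : ℕ) (hk : d ≤ k) :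
    ((U x * F x) a b).coeff k = -((F x * lam) a b).coeff k := by
  have h1 : HasDerivAt (fun y => (F y a b).coeff k) 0 x := by
    have : ∃ c : ℂ, ∀ y, (F y a b).coeff k = c := by
      rcases hk.eq_or_lt with rfl | hk
      · exact ⟨_, fun y => h.coeff_top y a b⟩
      · exact ⟨0, fun y => coeff_eq_zero_of_natDegree_lt ((h.natDegree_le y a b).trans_lt hk)⟩
    obtain ⟨c, hc⟩ := this
    simp_rw [hc]
    exact hasDerivAt_const x c
  have h2 := (h.hasDerivAt x a b k).unique h1
  rw [Matrix.add_apply, coeff_add] at h2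
  linear_combination h2

/-- As `F` is monic, the top coefficient of `U` survives in `U F`, which agrees with `-F Λ` in high
degrees; this gives a bound independent of `x`. -/
theorem natDegree_potential_le (h : IsLaxFamily d lam F U) {L : ℕ}
    (hL : ∀ a b, (lam a b).natDegree ≤ L) (x : ℝ) (a b : n) : (U x a b).natDegree ≤ L := by
  -- Induction on the excess `m` over `L`; the initial excess may depend on `x`, the final bound
  -- does not.
  have key : ∀ m, (∀ a b, (U x a b).natDegree ≤ L + m) → ∀ a b, (U x a b).natDegree ≤ L := by
    intro m
    induction m with
    | zero => exact fun h => h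
    | succ m ih =>
      intro hm
      refine ih fun a b => ?_
      have h0 : ((F x * lam) a b).coeff (L + (m + 1) + d) = 0 := by
        rw [Matrix.mul_apply, finsetSum_coeff]
        refine Finset.sum_eq_zero fun c _ => coeff_eq_zero_of_natDegree_lt ?_
        have h1 := h.natDegree_le x a c
        have h2 := hL c b
        have h3 := natDegree_mul_le (p := F x a c) (q := lam c b)
        omega
      have h1 := h.coeff_mul_eq x a b (L + (m + 1) + d) (by omega)
      rw [h0, Matrix.mul_apply, finsetSum_coeff] at h1
      simp_rw [coeff_mul_add_eq_of_natDegree_le (hm a _) (h.natDegree_le x _ b), h.coeff_top,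
        Matrix.one_apply] at h1
      simp only [mul_ite, mul_one, mul_zero, Finset.sum_ite_eq', Finset.mem_univ, if_true,
        neg_zero] at h1
      refine natDegree_le_iff_coeff_eq_zero.2 fun k hk => ?_
      rcases (show k = L + (m + 1) ∨ L + (m + 1) < k by omega) with rfl | hk'
      · exact h1
      · exact coeff_eq_zero_of_natDegree_lt ((hm a b).trans_lt hk')
  refine key (∑ a, ∑ b, (U x a b).natDegree) (fun a b => ?_) a b
  have h1 := Finset.single_le_sum (f := fun a => ∑ b, (U x a b).natDegree)
    (fun _ _ => Nat.zero_le _) (Finset.mem_univ a)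
  have h2 := Finset.single_le_sum (f := fun b => (U x a b).natDegree)
    (fun _ _ => Nat.zero_le _) (Finset.mem_univ b)
  beta_reduce at h1 h2
  omega

theorem continuous_coeff (h : IsLaxFamily d lam F U) (a b : n) (k : ℕ) :
    Continuous fun x => (F x a b).coeff k :=
  continuous_iff_continuousAt.2 fun x => (h.hasDerivAt x a b k).continuousAt

/-- Nothing is assumed on how `U` depends on `x`. In degree `k + d` the product `U F` contains `U_k`
and otherwise only higher coefficients of `U` times coefficients of `F`, so continuity descends from
the top degree. -/
theorem continuous_potential_coeff (h : IsLaxFamily d lam F U) {L : ℕ}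
    (hL : ∀ a b, (lam a b).natDegree ≤ L) (a b : n) (k : ℕ) :
    Continuous fun x => (U x a b).coeff k := by
  have key : ∀ m k, L < k + m → ∀ a b, Continuous fun x => (U x a b).coeff k := by
    intro m
    induction m with
    | zero =>
      intro k hk a b
      have : (fun x => (U x a b).coeff k) = fun _ => 0 := funext fun x =>
        coeff_eq_zero_of_natDegree_lt ((h.natDegree_potential_le hL x a b).trans_lt hk)
      rw [this]
      exact continuous_const
    | succ m ih =>
      intro k hk a b
      have hrec : ∀ x, (U x a b).coeff k = -((F x * lam) a b).coeff (k + d) -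
          ∑ c, ∑ q ∈ (Finset.HasAntidiagonal.antidiagonal (k + d)).erase (k, d),
            (U x a c).coeff q.1 * (F x c b).coeff q.2 := by
        intro x
        rw [← h.coeff_mul_eq x a b (k + d) (by omega), Matrix.mul_apply, finsetSum_coeff]
        have hc : ∀ c, (U x a c * F x c b).coeff (k + d) =
            (U x a c).coeff k * (1 : Matrix n n ℂ) c b +
            ∑ q ∈ (Finset.HasAntidiagonal.antidiagonal (k + d)).erase (k, d),
              (U x a c).coeff q.1 * (F x c b).coeff q.2 := fun c => by
          rw [coeff_mul, ← Finset.add_sum_erase _ _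
            (Finset.HasAntidiagonal.mem_antidiagonal.2 rfl : (k, d) ∈ _), h.coeff_top]
        simp_rw [hc, Finset.sum_add_distrib, Matrix.one_apply]
        simp
      simp_rw [hrec]
      refine Continuous.sub (Continuous.neg ?_) ?_
      · simp_rw [Matrix.mul_apply, finsetSum_coeff, coeff_mul]
        exact continuous_finsetSum _ fun c _ => continuous_finsetSum _ fun q _ =>
          (h.continuous_coeff a c q.1).mul continuous_const
      · refine continuous_finsetSum _ fun c _ => continuous_finsetSum _ fun q hq => ?_
        rw [Finset.mem_erase, Finset.HasAntidiagonal.mem_antidiagonal] at hq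
        obtain ⟨q₁, q₂⟩ := q
        obtain ⟨hq1, hq2⟩ := hq
        simp only at hq2
        -- For `q₁ < k` the factor of `F` has degree above `d` and vanishes, `q₁ = k` is the erased
        -- pair, and `q₁ > k` is the induction hypothesis.
        rcases lt_trichotomy q₁ k with hlt | rfl | hgt
        · have : (fun x => (U x a c).coeff q₁ * (F x c b).coeff q₂) = fun _ => 0 :=
            funext fun x => by
              rw [coeff_eq_zero_of_natDegree_lt (p := F x c b) (n := q₂)
                ((h.natDegree_le x c b).trans_lt (by omega)), mul_zero]
          simp only [this]
          exact continuous_const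
        · exact absurd (by rw [Prod.mk.injEq]; omega) hq1
        · exact (ih q₁ (by omega) a c).mul (h.continuous_coeff c b q₂)
  exact key (L + 1) k (by omega) a b

/-- The product rule, arranged so that one term is the expression of the derived equation and the
other is linear in `F·P`. -/
theorem hasDerivAt_polyAct (h : IsLaxFamily d lam F U) (A : Matrix ι ι ℂ)
    {P : ℝ → Matrix n ι ℂ} {P' : Matrix n ι ℂ} {x : ℝ}
    (hP : ∀ a i, HasDerivAt (fun y => P y a i) (P' a i) x) (a : n) (i : ι) :
    HasDerivAt (fun y => polyAct A (F y) (P y) a i)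
      ((polyAct A (F x) (P' + polyAct A lam (P x)) +
        polyAct A (U x) (polyAct A (F x) (P x))) a i) x := by
  have h1 : HasDerivAt (fun y => polyAct A (F y) (P y) a i)
      ((polyAct A (F x) P' + polyAct A (F x * lam + U x * F x) (P x)) a i) x := by
    simp_rw [Matrix.add_apply, polyAct_apply, ← Finset.sum_add_distrib]
    refine HasDerivAt.fun_sum fun b _ => HasDerivAt.fun_sum fun j _ => ?_
    exact (hP b j).mul (hasDerivAt_aeval (fun y => h.natDegree_le y a b)
      (fun k => h.hasDerivAt x a b k) A j i)
  rw [polyAct_add_left, polyAct_mul, polyAct_mul, ← add_assoc, ← polyAct_add_right] at h1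
  exact h1

/-- Propagation of the kernel along solutions of the derived equation. -/
theorem polyAct_eq_zero (h : IsLaxFamily d lam F U) (A : Matrix ι ι ℂ)
    {P P' : ℝ → Matrix n ι ℂ} (hP : ∀ x a i, HasDerivAt (fun y => P y a i) (P' x a i) x)
    (hder : ∀ x, polyAct A (F x) (P' x + polyAct A lam (P x)) = 0) {x₀ : ℝ}
    (h₀ : polyAct A (F x₀) (P x₀) = 0) (x : ℝ) : polyAct A (F x) (P x) = 0 := by
  obtain ⟨L, hL⟩ : ∃ L, ∀ a b, (lam a b).natDegree ≤ L := by
    refine ⟨∑ a, ∑ b, (lam a b).natDegree, fun a b => ?_⟩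
    exact (Finset.single_le_sum (f := fun b => (lam a b).natDegree)
      (fun _ _ => Nat.zero_le _) (Finset.mem_univ b)).trans
      (Finset.single_le_sum (f := fun a => ∑ b, (lam a b).natDegree)
      (fun _ _ => Nat.zero_le _) (Finset.mem_univ a))
  -- The derived equation removes the first term, leaving a homogeneous linear ODE for the entries
  -- of `F·P`.
  have key := linearODE_eq_zero (ι := n × ι)
    (y := fun x q => polyAct A (F x) (P x) q.1 q.2)
    (T := fun x => Matrix.of fun q r => aeval A (U x q.1 r.1) r.2 q.2)
    (fun q r => continuous_aeval (fun x => h.natDegree_potential_le hL x q.1 r.1)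
      (fun k => h.continuous_potential_coeff hL q.1 r.1 k) A r.2 q.2)
    (fun x q => by
      have h1 := h.hasDerivAt_polyAct A (hP x) q.1 q.2
      rw [hder, zero_add, polyAct_apply] at h1
      convert h1 using 1
      simp only [Matrix.mulVec, dotProduct, Matrix.of_apply, Fintype.sum_prod_type, mul_comm])
    (x₀ := x₀) (by rw [h₀]; rfl) x
  ext a i
  exact congrFun key (a, i)

theorem derived_eq_zero (h : IsLaxFamily d lam F U) (A : Matrix ι ι ℂ)
    {P : ℝ → Matrix n ι ℂ} {P' : Matrix n ι ℂ} {x : ℝ}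
    (hP : ∀ a i, HasDerivAt (fun y => P y a i) (P' a i) x)
    (hz : ∀ y, polyAct A (F y) (P y) = 0) :
    polyAct A (F x) (P' + polyAct A lam (P x)) = 0 := by
  ext a i
  have h1 := h.hasDerivAt_polyAct A hP a i
  simp_rw [hz, polyAct_zero_right, add_zero] at h1
  exact h1.unique (hasDerivAt_const x _)

end IsLaxFamily

end PolynomialFamilies

/-! ### Block-Toeplitz matrices as values at Jordan blocks -/

section Toeplitz

variable {N : ℕ} {s : ℕ}

theorem evalM_apply (F : Matrix (Fin N) (Fin N) ℂ[X]) (z : ℂ) (a b : Fin N) :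
    evalM F z a b = (F a b).eval z := rfl

theorem evalM_mul (F H : Matrix (Fin N) (Fin N) ℂ[X]) (z : ℂ) :
    evalM (F * H) z = evalM F z * evalM H z :=
  Matrix.map_mul (f := Polynomial.evalRingHom z)

theorem evalM_add (F H : Matrix (Fin N) (Fin N) ℂ[X]) (z : ℂ) :
    evalM (F + H) z = evalM F z + evalM H z := by
  ext a b; simp [evalM_apply]

theorem evalM_neg (F : Matrix (Fin N) (Fin N) ℂ[X]) (z : ℂ) :
    evalM (-F) z = -evalM F z := by
  ext a b; simp [evalM_apply]

theorem evalM_transpose (F : Matrix (Fin N) (Fin N) ℂ[X]) (z : ℂ) :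
    evalM Fᵀ z = (evalM F z)ᵀ := rfl

theorem upperToeplitz_eq_transpose (F : ℂ → Matrix (Fin N) (Fin N) ℂ) (z : ℂ) :
    upperToeplitz s F z = (lowerToeplitz s (fun w => (F w)ᵀ) z)ᵀ := rfl

theorem lowerToeplitz_congr {F H : ℂ → Matrix (Fin N) (Fin N) ℂ} {z : ℂ} (h : F =ᶠ[𝓝 z] H) :
    lowerToeplitz s F z = lowerToeplitz s H z := by
  ext i j
  simp only [lowerToeplitz, Matrix.of_apply]
  have : (fun w => F w i.2 j.2) =ᶠ[𝓝 z] fun w => H w i.2 j.2 := h.mono fun w hw => by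
    simp only [hw]
  rw [this.iteratedDeriv_eq]

/-- Lower-triangular Toeplitz matrices multiply by the Cauchy product of their symbols. -/
theorem sum_toeplitz_mul (u v : ℕ → ℂ) (i j : Fin s) :
    ∑ k : Fin s, (if k ≤ i then u (i.val - k.val) else 0) * (if j ≤ k then v (k.val - j.val) else 0)
      = if j ≤ i then ∑ l ∈ Finset.range (i.val - j.val + 1), u l * v (i.val - j.val - l)
        else 0 := by
  have h1 : ∀ k : Fin s, (if k ≤ i then u (i.val - k.val) else 0) *
      (if j ≤ k then v (k.val - j.val) else 0) =
      if k ∈ Finset.Icc j i then u (i.val - k.val) * v (k.val - j.val) else 0 := by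
    intro k
    simp only [Finset.mem_Icc]
    split_ifs <;> first | rfl | (exfalso; tauto) | simp
  simp_rw [h1, Finset.sum_ite_mem, Finset.univ_inter]
  split_ifs with hij
  · have hij' : j.val ≤ i.val := hij
    refine Finset.sum_bij (fun k _ => i.val - k.val) ?_ ?_ ?_ ?_
    · intro k hk
      rw [Finset.mem_Icc] at hk
      have h1 : j.val ≤ k.val := hk.1
      rw [Finset.mem_range]; omega
    · intro k hk k' hk' h
      rw [Finset.mem_Icc] at hk hk'
      have h1 : k.val ≤ i.val := hk.2
      have h2 : k'.val ≤ i.val := hk'.2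
      ext; omega
    · intro l hl
      rw [Finset.mem_range] at hl
      refine ⟨⟨i.val - l, by omega⟩, ?_, ?_⟩
      · rw [Finset.mem_Icc, Fin.le_def, Fin.le_def]
        simp only
        omega
      · simp only; omega
    · intro k hk
      rw [Finset.mem_Icc] at hk
      have h1 : j.val ≤ k.val := hk.1
      have h2 : k.val ≤ i.val := hk.2
      congr 2; omega
  · rw [Finset.Icc_eq_empty hij, Finset.sum_empty]

/-- Taking block-Toeplitz matrices is multiplicative. -/
theorem lowerToeplitz_mul {F H : ℂ → Matrix (Fin N) (Fin N) ℂ} {z : ℂ}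
    (hF : ∀ a b, AnalyticAt ℂ (fun w => F w a b) z)
    (hH : ∀ a b, AnalyticAt ℂ (fun w => H w a b) z) :
    lowerToeplitz s (fun w => F w * H w) z = lowerToeplitz s F z * lowerToeplitz s H z := by
  ext ⟨i, a⟩ ⟨j, b⟩
  rw [Matrix.mul_apply, Fintype.sum_prod_type, Finset.sum_comm]
  simp only [lowerToeplitz, Matrix.of_apply]
  have h1 := fun c => sum_toeplitz_mul
    (fun m => iteratedDeriv m (fun w => F w a c) z / (m.factorial : ℂ))
    (fun m => iteratedDeriv m (fun w => H w c b) z / (m.factorial : ℂ)) i j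
  beta_reduce at h1
  simp_rw [h1]
  split_ifs with hij
  · simp_rw [Matrix.mul_apply]
    rw [iteratedDeriv_fun_sum fun c _ => ((hF a c).contDiffAt.mul (hH c b).contDiffAt),
      Finset.sum_div]
    refine Finset.sum_congr rfl fun c _ => ?_
    -- Leibniz' rule: dividing by the factorials absorbs the binomial coefficients into the Cauchy
    -- product.
    rw [iteratedDeriv_fun_mul (hF a c).contDiffAt (hH c b).contDiffAt, Finset.sum_div]
    refine Finset.sum_congr rfl fun l hl => ?_
    have hl' : l ≤ i.val - j.val := Nat.lt_succ_iff.1 (Finset.mem_range.1 hl)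
    have h2 := Nat.choose_mul_factorial_mul_factorial hl'
    have h3 : (((i.val - j.val).choose l : ℕ) : ℂ) * (l.factorial : ℂ) *
      ((i.val - j.val - l).factorial : ℂ) = ((i.val - j.val).factorial : ℂ) := by exact_mod_cast h2
    have h4 : (l.factorial : ℂ) ≠ 0 := by exact_mod_cast l.factorial_ne_zero
    have h5 : ((i.val - j.val - l).factorial : ℂ) ≠ 0 := by
      exact_mod_cast (i.val - j.val - l).factorial_ne_zero
    have h6 : ((i.val - j.val).factorial : ℂ) ≠ 0 := by
      exact_mod_cast (i.val - j.val).factorial_ne_zero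
    field_simp
    rw [← h3]
    ring
  · simp

theorem iteratedDeriv_eval (f : ℂ[X]) (k : ℕ) (z : ℂ) :
    iteratedDeriv k (fun w => f.eval w) z / (k.factorial : ℂ) = (taylor z f).coeff k := by
  have h1 : ∀ k, iteratedDeriv k (fun w => f.eval w) = fun w => (derivative^[k] f).eval w := by
    intro k
    induction k with
    | zero => simp
    | succ k ih =>
      rw [iteratedDeriv_succ, ih, Function.iterate_succ_apply']
      funext w
      simp
  rw [h1, taylor_coeff, ← factorial_smul_hasseDeriv]
  have h4 : (k.factorial : ℂ) ≠ 0 := by exact_mod_cast k.factorial_ne_zero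
  simp [field]

theorem toeplitzH_one_pow (k : ℕ) (i j : Fin s) :
    (toeplitzH s 1 ^ k) j i = if j.val + k = i.val then 1 else 0 := by
  induction k generalizing i with
  | zero => simp [Matrix.one_apply, Fin.ext_iff]
  | succ k ih =>
    rw [pow_succ, Matrix.mul_apply]
    simp_rw [ih, toeplitzH, Matrix.of_apply]
    by_cases h : j.val + (k + 1) = i.val
    · rw [if_pos h, Finset.sum_eq_single ⟨j.val + k, by omega⟩]
      · simp; omega
      · intro c _ hc
        rw [if_neg, zero_mul]
        intro h'; exact hc (Fin.ext h'.symm)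
      · simp
    · rw [if_neg h]
      refine Finset.sum_eq_zero fun c _ => ?_
      split_ifs <;> first | omega | simp

/-- The Jordan block of size `s`. -/
noncomputable def jordanBlock (s : ℕ) (z : ℂ) : Matrix (Fin s) (Fin s) ℂ :=
  z • 1 + toeplitzH s 1

/-- `f(z + H)` is the Taylor expansion of `f` at `z` in the shift `H`, and each entry is met by at
most one power of `H`. -/
theorem aeval_jordanBlock (f : ℂ[X]) (z : ℂ) (i j : Fin s) :
    aeval (jordanBlock s z) f j i =
      if j ≤ i then (taylor z f).coeff (i.val - j.val) else 0 := by
  have h1 : aeval (jordanBlock s z) f = aeval (toeplitzH s 1) (taylor z f) := by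
    rw [taylor_apply, aeval_comp]
    congr 2
    simp [jordanBlock, Algebra.algebraMap_eq_smul_one, add_comm]
  -- The range is lengthened by `s` so that it contains `i - j` even beyond the degree.
  rw [h1, aeval_eq_sum_range' (n := (taylor z f).natDegree + s + 1) (by omega), Matrix.sum_apply]
  simp_rw [Matrix.smul_apply, toeplitzH_one_pow]
  split_ifs with h
  · have h' : j.val ≤ i.val := h
    rw [Finset.sum_eq_single (i.val - j.val)]
    · rw [if_pos (by omega)]; simp
    · intro k _ hk
      rw [if_neg (by omega)]; simp
    · intro hk
      exact absurd (Finset.mem_range.2 (by omega)) hk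
  · have h' : ¬ j.val ≤ i.val := h
    refine Finset.sum_eq_zero fun k _ => ?_
    rw [if_neg (by omega)]; simp

/-- The block-Toeplitz matrix of a matrix polynomial is its value at a Jordan block. -/
theorem lowerToeplitz_evalM (F : Matrix (Fin N) (Fin N) ℂ[X]) (z : ℂ) (i j : Fin s × Fin N) :
    lowerToeplitz s (evalM F) z i j = aeval (jordanBlock s z) (F i.2 j.2) j.1 i.1 := by
  rw [aeval_jordanBlock, ← iteratedDeriv_eval]
  rfl

theorem lowerToeplitz_evalM_mul (F H : Matrix (Fin N) (Fin N) ℂ[X]) (z : ℂ) :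
    lowerToeplitz s (evalM (F * H)) z =
      lowerToeplitz s (evalM F) z * lowerToeplitz s (evalM H) z := by
  rw [← lowerToeplitz_mul (F := evalM F) (H := evalM H)
    (fun a b => (F a b).differentiable.analyticAt z)
    (fun a b => (H a b).differentiable.analyticAt z)]
  simp_rw [← evalM_mul]

theorem lowerToeplitz_evalM_one (z : ℂ) :
    lowerToeplitz s (evalM (1 : Matrix (Fin N) (Fin N) ℂ[X])) z = 1 := by
  ext ⟨i, a⟩ ⟨j, b⟩
  rw [lowerToeplitz_evalM]
  by_cases h : a = b <;> by_cases h' : i = j <;> simp [h, h', Matrix.one_apply, eq_comm]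

/-- The map from matrix polynomials to block-Toeplitz matrices, as an algebra homomorphism. -/
noncomputable def toeplitzAlgHom (s : ℕ) (z : ℂ) :
    Matrix (Fin N) (Fin N) ℂ[X] →ₐ[ℂ] Matrix (Fin s × Fin N) (Fin s × Fin N) ℂ :=
  AlgHom.ofLinearMap
    { toFun := fun F => lowerToeplitz s (evalM F) z
      map_add' := fun F H => by
        ext i j
        simp [lowerToeplitz_evalM]
      map_smul' := fun c F => by
        ext i j
        simp [lowerToeplitz_evalM] }
    (lowerToeplitz_evalM_one z) (fun F H => lowerToeplitz_evalM_mul F H z)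

theorem toeplitzAlgHom_apply (z : ℂ) (F : Matrix (Fin N) (Fin N) ℂ[X]) :
    toeplitzAlgHom s z F = lowerToeplitz s (evalM F) z := rfl

/-- The inverse is the Toeplitz matrix of `q⁻¹`, analytic near `z` but in general no polynomial. It
serves to clear the denominator of the soliton matrix. -/
theorem isUnit_lowerToeplitz_smul_one {q : ℂ[X]} {z : ℂ} (hq : q.eval z ≠ 0) :
    IsUnit (lowerToeplitz s (evalM (q • (1 : Matrix (Fin N) (Fin N) ℂ[X]))) z) := by
  set Q := q • (1 : Matrix (Fin N) (Fin N) ℂ[X]) with hQ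
  let R : ℂ → Matrix (Fin N) (Fin N) ℂ := fun w => Matrix.diagonal fun _ => (q.eval w)⁻¹
  have h0 : ∀ a b, AnalyticAt ℂ (fun w => R w a b) z := by
    intro a b
    have h2 : AnalyticAt ℂ (fun w => q.eval w) z := q.differentiable.analyticAt z
    by_cases hab : a = b
    · simpa [R, hab] using h2.fun_inv hq
    · simpa [R, hab] using analyticAt_const
  have h1 := lowerToeplitz_mul (s := s) (F := evalM Q) (H := R)
    (fun a b => (Q a b).differentiable.analyticAt z) h0
  have h2 : (fun w => evalM Q w * R w) =ᶠ[𝓝 z] evalM 1 := by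
    filter_upwards [q.continuous.continuousAt.eventually_ne hq] with w hw
    ext a b
    by_cases hab : a = b <;> simp [evalM_apply, hQ, R, hab, hw]
  rw [lowerToeplitz_congr h2, lowerToeplitz_evalM_one] at h1
  exact ⟨⟨_, _, h1.symm, mul_eq_one_comm.1 h1.symm⟩, rfl⟩

/-! ### Exponentials of block-Toeplitz matrices -/

section Exponential

attribute [local instance] Matrix.linftyOpNormedRing Matrix.linftyOpNormedAlgebra

/-- Truncations of the exponential series of a matrix polynomial. -/
noncomputable def expTrunc (F : Matrix (Fin N) (Fin N) ℂ[X]) (m : ℕ) :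
    Matrix (Fin N) (Fin N) ℂ[X] :=
  ∑ k ∈ Finset.range m, ((k.factorial : ℂ)⁻¹) • F ^ k

theorem norm_entry_le {n : Type*} [Fintype n] [DecidableEq n] (A : Matrix n n ℂ) (a b : n) :
    ‖A a b‖ ≤ ‖A‖ := by
  rw [Matrix.linfty_opNorm_def]
  have h1 := Finset.le_sup (f := fun i => ∑ j, ‖A i j‖₊) (Finset.mem_univ a)
  have h2 := Finset.single_le_sum (f := fun j => ‖A a j‖₊) (fun _ _ => zero_le)
    (Finset.mem_univ b)
  exact_mod_cast h2.trans h1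

theorem tendsto_exp_entry {n : Type*} [Fintype n] [DecidableEq n] (A : Matrix n n ℂ) (a b : n) :
    HasSum (fun k => (k.factorial : ℂ)⁻¹ * (A ^ k) a b) (NormedSpace.exp A a b) := by
  have h1 := NormedSpace.exp_series_hasSum_exp' (𝕂 := ℂ) A
  exact (h1.map (Matrix.entryAddMonoidHom ℂ a b)
    ((continuous_id.matrix_elem a b) : Continuous fun M : Matrix n n ℂ => M a b))

theorem eval_expTrunc (F : Matrix (Fin N) (Fin N) ℂ[X]) (m : ℕ) (z : ℂ) (a b : Fin N) :
    (expTrunc F m a b).eval z =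
      ∑ k ∈ Finset.range m, (k.factorial : ℂ)⁻¹ * (evalM F z ^ k) a b := by
  have h1 : ∀ k, evalM F z ^ k = evalM (F ^ k) z := fun k =>
    (map_pow (Polynomial.evalRingHom z).mapMatrix F k).symm
  simp [expTrunc, Matrix.sum_apply, eval_finsetSum, h1, evalM_apply]

/-- The Weierstrass test with majorant `c ^ k / k!` on a compact set where `‖F(z)‖ ≤ c`. -/
theorem tendstoLocallyUniformlyOn_expTrunc (F : Matrix (Fin N) (Fin N) ℂ[X]) (a b : Fin N) :
    TendstoLocallyUniformlyOn (fun m z => (expTrunc F m a b).eval z)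
      (fun z => NormedSpace.exp (evalM F z) a b) Filter.atTop Set.univ := by
  have : Nonempty (Fin N) := ⟨a⟩
  rw [tendstoLocallyUniformlyOn_iff_forall_isCompact isOpen_univ]
  intro K _ hK
  have hcont : Continuous fun z => evalM F z :=
    continuous_matrix fun a b => (F a b).continuous
  obtain ⟨c, hc⟩ := hK.bddAbove_image (f := fun z => ‖evalM F z‖) hcont.norm.continuousOn
  have key := tendstoUniformlyOn_tsum_nat
    (f := fun k z => (k.factorial : ℂ)⁻¹ * (evalM F z ^ k) a b)
    (u := fun k => c ^ k / k.factorial) (Real.summable_pow_div_factorial c) (s := K)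
    (fun k z hz => by
      have hcz : ‖evalM F z‖ ≤ c := hc ⟨z, hz, rfl⟩
      rw [norm_mul, norm_inv, Complex.norm_natCast, div_eq_inv_mul]
      gcongr
      exact (norm_entry_le _ a b).trans ((norm_pow_le _ k).trans
        (pow_le_pow_left₀ (norm_nonneg _) hcz k)))
  simp_rw [eval_expTrunc]
  refine key.congr_right fun z _ => ?_
  exact (tendsto_exp_entry (evalM F z) a b).tsum_eq

/-- Locally uniform limits of holomorphic functions may be differentiated any number of times; the
induction has to carry holomorphy along. -/
theorem tendsto_iteratedDeriv {f : ℕ → ℂ → ℂ} {g : ℂ → ℂ}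
    (h : TendstoLocallyUniformlyOn f g Filter.atTop Set.univ) (hf : ∀ m, Differentiable ℂ (f m))
    (k : ℕ) (z : ℂ) :
    Filter.Tendsto (fun m => iteratedDeriv k (f m) z) Filter.atTop (𝓝 (iteratedDeriv k g z)) := by
  have key : TendstoLocallyUniformlyOn (fun m => iteratedDeriv k (f m)) (iteratedDeriv k g)
      Filter.atTop Set.univ ∧ ∀ m, Differentiable ℂ (iteratedDeriv k (f m)) := by
    induction k with
    | zero => simpa using ⟨h, hf⟩
    | succ k ih =>
      simp_rw [iteratedDeriv_succ]
      refine ⟨ih.1.deriv (Filter.Eventually.of_forall fun m => (ih.2 m).differentiableOn)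
        isOpen_univ, fun m => ?_⟩
      exact differentiableOn_univ.1 ((ih.2 m).differentiableOn.deriv isOpen_univ)
  exact key.1.tendsto_at (Set.mem_univ z)

/-- The exponential of a block-Toeplitz matrix is the block-Toeplitz matrix of the exponential. -/
theorem exp_lowerToeplitz (F : Matrix (Fin N) (Fin N) ℂ[X]) (z : ℂ) :
    NormedSpace.exp (lowerToeplitz s (evalM F) z) =
      lowerToeplitz s (fun w => NormedSpace.exp (evalM F w)) z := by
  ext i j
  have h1 := (tendsto_exp_entry (lowerToeplitz s (evalM F) z) i j).tendsto_sum_nat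
  -- The Toeplitz map is an algebra homomorphism on polynomials, so it carries truncations of the
  -- exponential series to truncations.
  have h2 : ∀ m, ∑ k ∈ Finset.range m,
      (k.factorial : ℂ)⁻¹ * (lowerToeplitz s (evalM F) z ^ k) i j =
      lowerToeplitz s (evalM (expTrunc F m)) z i j := by
    intro m
    rw [← toeplitzAlgHom_apply, ← toeplitzAlgHom_apply, expTrunc, map_sum, Matrix.sum_apply]
    simp
  simp_rw [h2] at h1
  refine tendsto_nhds_unique h1 ?_
  simp only [lowerToeplitz, Matrix.of_apply]
  split_ifs
  · exact (tendsto_iteratedDeriv (tendstoLocallyUniformlyOn_expTrunc F i.2 j.2)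
      (fun m => (expTrunc F m i.2 j.2).differentiable) _ z).div_const _
  · exact tendsto_const_nhds

end Exponential

end Toeplitz

/-! ### The double sums in `K` and `K̄` as truncated geometric series -/

section Sylvester

theorem sum_range_smul_shift {E : Type*} [AddCommGroup E] [Module ℂ E] (b : ℕ) (g : ℕ → ℂ)
    (h : ℕ → E) (hb : h b = 0) :
    ∑ l ∈ Finset.range b, g l • h (l + 1) =
      ∑ l ∈ Finset.range b, (if l = 0 then 0 else g (l - 1)) • h l := by
  have h1 := Finset.sum_range_succ' (fun l => (if l = 0 then 0 else g (l - 1)) • h l) b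
  rw [Finset.sum_range_succ, hb, smul_zero, add_zero] at h1
  rw [h1]
  simp

/-- The coefficients of the expansion of `1 / (c + b - a)` in powers of `a` and `b`. -/
noncomputable def geomCoeff (c : ℂ) (j l : ℕ) : ℂ :=
  (-1 : ℂ) ^ l * ((j + l).factorial : ℂ) / ((j.factorial : ℂ) * (l.factorial : ℂ))
    / c ^ (j + l + 1)

/-- Comparison of coefficients of `a^j b^l` in `(c + b - a) · 1 / (c + b - a) = 1`. -/
theorem geomCoeff_rec {c : ℂ} (hc : c ≠ 0) (j l : ℕ) :
    c * geomCoeff c j l + (if l = 0 then 0 else geomCoeff c j (l - 1))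
      - (if j = 0 then 0 else geomCoeff c (j - 1) l) = if j = 0 ∧ l = 0 then 1 else 0 := by
  have hf : ∀ k : ℕ, (k.factorial : ℂ) ≠ 0 := fun k => by exact_mod_cast k.factorial_ne_zero
  have hs : ∀ k : ℕ, (k : ℂ) + 1 ≠ 0 := fun k => by exact_mod_cast k.succ_ne_zero
  unfold geomCoeff
  rcases j with _ | j <;> rcases l with _ | l
  · simp [hc]
  · have := hf l; have := hs l
    simp [Nat.factorial_succ]
    field_simp
    ring
  · have := hf j; have := hs j
    simp [Nat.factorial_succ]
    field_simp
    ring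
  · have h1 := hf j; have h2 := hf l; have h3 := hs j; have h4 := hs l
    have e1 : j + 1 + (l + 1) = j + l + 1 + 1 := by ring
    have e2 : j + 1 + l = j + l + 1 := by ring
    have e3 : j + (l + 1) = j + l + 1 := by ring
    simp only [Nat.add_sub_cancel, e1, e2, e3, Nat.factorial_succ, Nat.succ_ne_zero, if_false,
      and_self]
    push_cast
    field_simp
    ring

/-- Raising `j` and `l` plays the role of multiplication by `a` and `b`. The boundary conditions
make both shifts nilpotent, so the truncated series inverts `c + b - a` exactly. -/
theorem sum_geomCoeff {E : Type*} [AddCommGroup E] [Module ℂ E] {a b : ℕ} (ha : 0 < a)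
    (hb : 0 < b) {c : ℂ} (hc : c ≠ 0) (f : ℕ → ℕ → E) (hfa : ∀ l, f a l = 0)
    (hfb : ∀ j, f j b = 0) :
    ∑ j ∈ Finset.range a, ∑ l ∈ Finset.range b,
      geomCoeff c j l • (c • f j l + f j (l + 1) - f (j + 1) l) = f 0 0 := by
  have h1 : ∑ j ∈ Finset.range a, ∑ l ∈ Finset.range b, geomCoeff c j l • f j (l + 1) =
      ∑ j ∈ Finset.range a, ∑ l ∈ Finset.range b,
        (if l = 0 then 0 else geomCoeff c j (l - 1)) • f j l :=
    Finset.sum_congr rfl fun j _ => sum_range_smul_shift b (geomCoeff c j) (f j) (hfb j)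
  have h2 : ∑ j ∈ Finset.range a, ∑ l ∈ Finset.range b, geomCoeff c j l • f (j + 1) l =
      ∑ j ∈ Finset.range a, ∑ l ∈ Finset.range b,
        (if j = 0 then 0 else geomCoeff c (j - 1) l) • f j l := by
    rw [Finset.sum_comm]
    conv_rhs => rw [Finset.sum_comm]
    exact Finset.sum_congr rfl fun l _ =>
      sum_range_smul_shift a (fun j => geomCoeff c j l) (fun j => f j l) (hfa l)
  simp_rw [smul_sub, smul_add, Finset.sum_sub_distrib, Finset.sum_add_distrib, h1, h2,
    ← Finset.sum_add_distrib, ← Finset.sum_sub_distrib, smul_smul, ← add_smul, ← sub_smul]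
  have h3 : ∀ j l, geomCoeff c j l * c + (if l = 0 then 0 else geomCoeff c j (l - 1))
      - (if j = 0 then 0 else geomCoeff c (j - 1) l) = if j = 0 ∧ l = 0 then 1 else 0 :=
    fun j l => by rw [mul_comm, geomCoeff_rec hc]
  simp_rw [h3]
  rw [Finset.sum_eq_single 0, Finset.sum_eq_single 0]
  · simp
  · intro l _ hl; simp [hl]
  · intro h; exact absurd (Finset.mem_range.2 hb) h
  · intro j _ hj; simp [hj]
  · intro h; exact absurd (Finset.mem_range.2 ha) h

theorem toeplitzH_neg_mul {s m : ℕ} (j : ℕ) (Y : Matrix (Fin s) (Fin m) ℂ) (α : Fin s)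
    (β : Fin m) : (toeplitzH s (-(j : ℤ)) * Y) α β =
      if h : j ≤ α.val then Y ⟨α.val - j, by omega⟩ β else 0 := by
  rw [Matrix.mul_apply]
  simp_rw [toeplitzH, Matrix.of_apply]
  split_ifs with h
  · rw [Finset.sum_eq_single ⟨α.val - j, by omega⟩]
    · rw [if_pos (by simp only; omega), one_mul]
    · intro γ _ hγ
      rw [if_neg, zero_mul]
      intro h'; exact hγ (Fin.ext (by simp only; omega))
    · simp
  · refine Finset.sum_eq_zero fun γ _ => ?_
    rw [if_neg (by omega), zero_mul]

theorem mul_toeplitzH_one {s m : ℕ} (Y : Matrix (Fin m) (Fin s) ℂ) (α : Fin m)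
    (β : Fin s) : (Y * toeplitzH s 1) α β =
      if h : 1 ≤ β.val then Y α ⟨β.val - 1, by omega⟩ else 0 := by
  rw [Matrix.mul_apply]
  simp_rw [toeplitzH, Matrix.of_apply]
  split_ifs with h
  · rw [Finset.sum_eq_single ⟨β.val - 1, by omega⟩]
    · rw [if_pos (by simp only; omega), mul_one]
    · intro γ _ hγ
      rw [if_neg, mul_zero]
      intro h'; exact hγ (Fin.ext (by simp only; omega))
    · simp
  · refine Finset.sum_eq_zero fun γ _ => ?_
    rw [if_neg (by omega), mul_zero]

theorem toeplitzH_transpose (s : ℕ) (j : ℤ) : (toeplitzH s j)ᵀ = toeplitzH s (-j) := by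
  ext α β
  simp only [toeplitzH, Matrix.transpose_apply, Matrix.of_apply]
  congr 1
  rw [eq_iff_iff]
  constructor <;> intro h <;> omega

end Sylvester

/-! ### Exchange of zeros, resolvents, and the Sylvester equation for `K̄` -/

namespace ZeroData

variable (D : ZeroData) {N : ℕ}

/-- The same data with the roles of the two zeros of each pair exchanged. -/
@[reducible] def dual : ZeroData where
  NZ := D.NZ
  k := D.kbar
  kbar := D.k
  k_injective := D.kbar_injective
  kbar_injective := D.k_injective
  k_ne_kbar m n := (D.k_ne_kbar n m).symm
  r := D.r
  r_pos := D.r_pos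
  s := D.s
  s_pos := D.s_pos
  s_antitone := D.s_antitone

/-- The block-diagonal matrix of Jordan blocks with `D(z) = (z - A)⁻¹`. -/
noncomputable def jordan : Matrix D.Idx D.Idx ℂ :=
  Matrix.blockDiagonal' fun ν : D.Block => jordanBlock (D.size ν) (D.κ ν)

/-- The block-diagonal matrix with `D̄(z) = (z - Ā)⁻¹`. -/
noncomputable def jordanBar : Matrix D.Idx D.Idx ℂ := D.dual.jordanᵀ

/-- `D(z)` is a resolvent, so a matrix commuting with `A` commutes with all `D(z)`. -/
theorem sub_jordan_mul_poleD {z : ℂ} (hz : z ∉ Set.range D.k) :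
    (z • 1 - D.jordan) * D.poleD z = 1 := by
  have h1 : (z • 1 : Matrix D.Idx D.Idx ℂ) - D.jordan =
      Matrix.blockDiagonal' fun ν : D.Block => z • 1 - jordanBlock (D.size ν) (D.κ ν) := by
    rw [jordan, ← Matrix.blockDiagonal'_one, ← Matrix.blockDiagonal'_smul,
      ← Matrix.blockDiagonal'_sub]
    rfl
  rw [h1, poleD, ← Matrix.blockDiagonal'_mul, ← Matrix.blockDiagonal'_one]
  congr 1
  funext ν
  have hz' : z - D.κ ν ≠ 0 := sub_ne_zero.2 fun h => hz ⟨ν.1, h.symm⟩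
  rw [jordanBlock, ← sub_sub, ← sub_smul, Matrix.sub_mul, Matrix.smul_mul, Matrix.one_mul]
  ext α β
  rw [Matrix.sub_apply, Matrix.mul_apply]
  simp_rw [toeplitzH, Matrix.smul_apply, Matrix.of_apply]
  have h2 : ∑ γ : Fin (D.size ν), (if (α.val : ℤ) = (γ.val : ℤ) - 1 then (1 : ℂ) else 0) *
      (if γ ≤ β then 1 / (z - D.κ ν) ^ (β.val - γ.val + 1) else 0) =
      if α < β then 1 / (z - D.κ ν) ^ (β.val - α.val) else 0 := by
    by_cases hαβ : α < β
    · have : α.val < β.val := hαβ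
      rw [if_pos hαβ, Finset.sum_eq_single ⟨α.val + 1, by omega⟩]
      · rw [if_pos (by simp), if_pos (by rw [Fin.le_def]; exact this), one_mul]
        congr 3
        simp only; omega
      · intro γ _ hγ
        rw [if_neg, zero_mul]
        intro h'; exact hγ (Fin.ext (by simp only; omega))
      · simp
    · rw [if_neg hαβ]
      have : ¬ α.val < β.val := hαβ
      refine Finset.sum_eq_zero fun γ _ => ?_
      by_cases h : (α.val : ℤ) = (γ.val : ℤ) - 1
      · rw [if_neg (c := γ ≤ β) (by rw [Fin.le_def]; omega), mul_zero]
      · rw [if_neg h, zero_mul]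
  rw [h2]
  change _ = (1 : Matrix (Fin (D.size ν)) (Fin (D.size ν)) ℂ) α β
  rcases lt_trichotomy α β with h | rfl | h
  · rw [if_pos h.le, if_pos h, Matrix.one_apply_ne h.ne, smul_eq_mul, pow_succ]
    field_simp
    simp
  · simp [hz']
  · rw [if_neg (not_le.2 h), if_neg (not_lt.2 h.le), Matrix.one_apply_ne h.ne']
    simp

theorem poleDbar_eq_transpose (z : ℂ) : D.poleDbar z = (D.dual.poleD z)ᵀ := by
  rw [poleD, Matrix.blockDiagonal'_transpose]
  rfl

theorem sub_jordanBar_mul_poleDbar {z : ℂ} (hz : z ∉ Set.range D.kbar) :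
    (z • 1 - D.jordanBar) * D.poleDbar z = 1 := by
  have h1 := congrArg Matrix.transpose
    (mul_eq_one_comm.1 (D.dual.sub_jordan_mul_poleD (z := z) hz))
  rw [Matrix.transpose_mul, Matrix.transpose_sub, Matrix.transpose_smul, Matrix.transpose_one,
    ← poleDbar_eq_transpose] at h1
  exact h1

theorem eval_charpoly_jordan_ne_zero {z : ℂ} (hz : z ∉ Set.range D.k) :
    D.jordan.charpoly.eval z ≠ 0 := by
  have h1 : D.jordan.charpoly.eval z = (z • 1 - D.jordan).det := by
    rw [Matrix.eval_charpoly, Matrix.scalar_apply, Matrix.smul_one_eq_diagonal]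
  rw [h1]
  intro h0
  have := congrArg Matrix.det (D.sub_jordan_mul_poleD hz)
  rw [Matrix.det_mul, h0, zero_mul, Matrix.det_one] at this
  exact zero_ne_one this

theorem charpoly_jordanBar : D.jordanBar.charpoly = D.dual.jordan.charpoly :=
  Matrix.charpoly_transpose _

theorem eval_charpoly_jordanBar_ne_zero {z : ℂ} (hz : z ∉ Set.range D.kbar) :
    D.jordanBar.charpoly.eval z ≠ 0 := by
  rw [charpoly_jordanBar]
  exact D.dual.eval_charpoly_jordan_ne_zero hz

/-- The roots of the two polynomials lie among the `k_n` and the `k̄_n`, which are disjoint. -/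
theorem isCoprime_charpoly : IsCoprime D.jordan.charpoly D.jordanBar.charpoly := by
  refine (Polynomial.isCoprime_iff_aeval_ne_zero_of_isAlgClosed ℂ ℂ _ _).2 fun z => ?_
  simp only [Polynomial.coe_aeval_eq_eval]
  by_cases hz : z ∈ Set.range D.k
  · right
    refine D.eval_charpoly_jordanBar_ne_zero ?_
    rintro ⟨n, hn⟩
    obtain ⟨m, hm⟩ := hz
    exact D.k_ne_kbar m n (hm.trans hn.symm)
  · exact Or.inl (D.eval_charpoly_jordan_ne_zero hz)

variable {D}

theorem mul_blockDiagonal'_apply (X : Matrix D.Idx D.Idx ℂ)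
    (B : ∀ ν : D.Block, Matrix (Fin (D.size ν)) (Fin (D.size ν)) ℂ) (i : D.Idx) (μ : D.Block)
    (β : Fin (D.size μ)) :
    (X * Matrix.blockDiagonal' B) i ⟨μ, β⟩ = ∑ γ, X i ⟨μ, γ⟩ * B μ γ β := by
  rw [Matrix.mul_apply, Fintype.sum_sigma, Finset.sum_eq_single μ]
  · simp_rw [Matrix.blockDiagonal'_apply_eq]
  · intro ν _ hν
    refine Finset.sum_eq_zero fun γ _ => ?_
    rw [Matrix.blockDiagonal'_apply_ne _ _ _ hν, mul_zero]
  · simp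

theorem blockDiagonal'_mul_apply (X : Matrix D.Idx D.Idx ℂ)
    (B : ∀ ν : D.Block, Matrix (Fin (D.size ν)) (Fin (D.size ν)) ℂ) (j : D.Idx) (ν : D.Block)
    (α : Fin (D.size ν)) :
    (Matrix.blockDiagonal' B * X) ⟨ν, α⟩ j = ∑ γ, B ν α γ * X ⟨ν, γ⟩ j := by
  rw [Matrix.mul_apply, Fintype.sum_sigma, Finset.sum_eq_single ν]
  · simp_rw [Matrix.blockDiagonal'_apply_eq]
  · intro μ _ hμ
    refine Finset.sum_eq_zero fun γ _ => ?_
    rw [Matrix.blockDiagonal'_apply_ne _ _ _ hμ.symm, zero_mul]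
  · simp

theorem blockKbar_eq (p pbar : D.Vecs N) (ν μ : D.Block) :
    blockKbar p pbar ν μ = ∑ j ∈ Finset.range (D.size ν), ∑ l ∈ Finset.range (D.size μ),
      geomCoeff (D.κ μ - D.κbar ν) j l •
        (toeplitzH (D.size ν) (-(j : ℤ)) * innerQbar p pbar ν μ l) := rfl

theorem κ_sub_κbar_ne_zero (ν μ : D.Block) : D.κ μ - D.κbar ν ≠ 0 :=
  sub_ne_zero.2 (D.k_ne_kbar _ _)

/-- Right multiplication by the shift raises `l`, left multiplication by its transpose raises `j`.
With `c = κ_μ - κ̄_ν` the Sylvester operator is thus the operator `c + b - a` which the double sum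
inverts. -/
theorem blockKbar_sylvester (p pbar : D.Vecs N) (ν μ : D.Block) :
    blockKbar p pbar ν μ * jordanBlock (D.size μ) (D.κ μ) -
      (jordanBlock (D.size ν) (D.κbar ν))ᵀ * blockKbar p pbar ν μ =
      Matrix.of fun α β => pbar ⟨ν, α⟩ ⬝ᵥ p ⟨μ, β⟩ := by
  set f : ℕ → ℕ → Matrix (Fin (D.size ν)) (Fin (D.size μ)) ℂ := fun j l =>
    toeplitzH (D.size ν) (-(j : ℤ)) * innerQbar p pbar ν μ l
  have hentry : ∀ j l α β, f j l α β =
      if h : j ≤ α.val then innerQbar p pbar ν μ l ⟨α.val - j, by omega⟩ β else 0 :=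
    fun j l α β => toeplitzH_neg_mul j _ α β
  have hr : ∀ j l, f j l * toeplitzH (D.size μ) 1 = f j (l + 1) := by
    intro j l
    ext α β
    rw [mul_toeplitzH_one, hentry]
    simp_rw [hentry, innerQbar, Matrix.of_apply]
    by_cases h1 : j ≤ α.val <;> by_cases h2 : l + 1 ≤ β.val
    · have h3 : 1 ≤ β.val := by omega
      have h4 : l ≤ β.val - 1 := by omega
      simp only [h1, h2, h3, h4, dif_pos, if_pos]
      have h5 : β.val - 1 - l = β.val - (l + 1) := by omega
      simp only [h5]
    · simp only [h1, h2, dif_pos, if_false]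
      split_ifs <;> first | rfl | (exfalso; omega)
    · simp [h1]
    · simp [h1]
  have hl : ∀ j l, (toeplitzH (D.size ν) 1)ᵀ * f j l = f (j + 1) l := by
    intro j l
    ext α β
    have h0 := toeplitzH_neg_mul 1 (f j l) α β
    rw [Nat.cast_one] at h0
    rw [toeplitzH_transpose, h0, hentry]
    by_cases h1 : j + 1 ≤ α.val
    · have h2 : 1 ≤ α.val := by omega
      have h3 : j ≤ α.val - 1 := by omega
      have h5 : α.val - 1 - j = α.val - (j + 1) := by omega
      simp only [h1, h2, dif_pos, hentry, h3, h5]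
    · rw [dif_neg h1]
      split_ifs with h2
      · rw [hentry, dif_neg (by simp only; omega)]
      · rfl
  have hfa : ∀ l, f (D.size ν) l = 0 := fun l => by
    ext α β
    rw [hentry, dif_neg (by omega)]; rfl
  have hfb : ∀ j, f j (D.size μ) = 0 := fun j => by
    ext α β
    rw [hentry]
    simp only [innerQbar, Matrix.of_apply]
    simp [show ¬ D.size μ ≤ β.val by omega]
  have key := sum_geomCoeff (D.s_pos ν.1 ν.2) (D.s_pos μ.1 μ.2) (κ_sub_κbar_ne_zero ν μ) f hfa hfb
  have h00 : f 0 0 = Matrix.of fun α β => pbar ⟨ν, α⟩ ⬝ᵥ p ⟨μ, β⟩ := by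
    ext α β
    rw [hentry]
    simp [innerQbar]
  rw [← h00, ← key, blockKbar_eq]
  simp_rw [Matrix.sum_mul, Matrix.mul_sum, ← Finset.sum_sub_distrib]
  refine Finset.sum_congr rfl fun j _ => Finset.sum_congr rfl fun l _ => ?_
  change geomCoeff _ j l • f j l * _ - _ * geomCoeff _ j l • f j l = _
  rw [Matrix.smul_mul, Matrix.mul_smul, ← smul_sub]
  congr 1
  rw [jordanBlock, jordanBlock, Matrix.transpose_add, Matrix.transpose_smul, Matrix.transpose_one,
    Matrix.mul_add, Matrix.add_mul, hr, hl, Matrix.mul_smul, Matrix.smul_mul, Matrix.mul_one,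
    Matrix.one_mul, sub_smul]
  abel

/-- `K̄` solves the Sylvester equation `K̄ A - Ā K̄ = P̄ P`. -/
theorem matKbar_sylvester (p pbar : D.Vecs N) :
    matKbar p pbar * D.jordan - D.jordanBar * matKbar p pbar = rows pbar * cols p := by
  ext ⟨ν, α⟩ ⟨μ, β⟩
  have h1 : D.jordanBar =
      Matrix.blockDiagonal' fun ν : D.Block => (jordanBlock (D.size ν) (D.κbar ν))ᵀ :=
    Matrix.blockDiagonal'_transpose _
  rw [Matrix.sub_apply, jordan, h1, mul_blockDiagonal'_apply, blockDiagonal'_mul_apply]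
  have h2 := congrFun (congrFun (blockKbar_sylvester p pbar ν μ) α) β
  rw [Matrix.sub_apply, Matrix.mul_apply, Matrix.mul_apply] at h2
  exact h2

/-- Makes a separate study of `K` unnecessary. -/
theorem matKbar_dual (p pbar : D.Vecs N) :
    matKbar (D := D.dual) pbar p = (matK p pbar)ᵀ := by
  ext ⟨ν, α⟩ ⟨μ, β⟩
  change blockKbar (D := D.dual) pbar p ν μ α β = blockK p pbar μ ν β α
  rw [blockKbar, blockK, Finset.sum_comm, Matrix.sum_apply, Matrix.sum_apply]
  refine Finset.sum_congr rfl fun l _ => ?_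
  rw [Matrix.sum_apply, Matrix.sum_apply]
  refine Finset.sum_congr rfl fun j _ => ?_
  rw [Matrix.smul_apply, Matrix.smul_apply]
  have h1 : innerQ p pbar μ ν l * toeplitzH (D.size ν) (j : ℤ) =
      (toeplitzH (D.size ν) (-(j : ℤ)) * innerQbar (D := D.dual) pbar p ν μ l)ᵀ := by
    rw [Matrix.transpose_mul, toeplitzH_transpose, neg_neg]
    congr 1
    ext γ δ
    simp only [innerQ, innerQbar, Matrix.of_apply, Matrix.transpose_apply]
    split_ifs
    · exact dotProduct_comm _ _
    · rfl
  rw [h1, add_comm j l, mul_comm (j.factorial : ℂ)]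
  rfl

end ZeroData

/-! ### Degree and leading coefficient of the numerator -/

section Degree

variable {n ι : Type*} [DecidableEq n] [Fintype ι] [DecidableEq ι]

theorem coeff_adjugate_charmatrix (A : Matrix ι ι ℂ) (i j : ι) {k : ℕ} (hk : Fintype.card ι ≤ k) :
    (adjugate (charmatrix A) i j).coeff k = 0 := by
  have : Nonempty ι := ⟨i⟩
  have hι : 0 < Fintype.card ι := Fintype.card_pos
  rw [← matPolyEquiv_coeff_apply]
  -- As a polynomial with matrix coefficients `X - A` is monic, so degrees add despite
  -- noncommutativity; the product with the adjugate has degree at most the size of `A`.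
  have h1 := congrArg matPolyEquiv (Matrix.mul_adjugate (charmatrix A))
  rw [map_mul, matPolyEquiv_charmatrix, matPolyEquiv_smul_one] at h1
  set Q := matPolyEquiv (adjugate (charmatrix A))
  by_cases hQ : Q = 0
  · simp [hQ]
  · have h2 := (monic_X_sub_C A).natDegree_mul' hQ
    rw [h1, natDegree_X_sub_C] at h2
    have h3 := natDegree_map_le (f := algebraMap ℂ (Matrix ι ι ℂ)) (p := (charmatrix A).det)
    have h4 : (charmatrix A).det.natDegree = Fintype.card ι := Matrix.charpoly_natDegree_eq_dim A
    rw [coeff_eq_zero_of_natDegree_lt (by omega)]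
    rfl

/-- The polynomial form of `Γ(∞) = I`: the second summand has degree below the size of `A'`. -/
theorem coeff_solitonPoly (A' M : Matrix ι ι ℂ) (P : Matrix n ι ℂ) (P' : Matrix ι n ℂ) (a b : n)
    {k : ℕ} (hk : Fintype.card ι ≤ k) :
    (solitonPoly A' M P P' a b).coeff k = A'.charpoly.coeff k * (1 : Matrix n n ℂ) a b := by
  have h1 : (((P * M⁻¹).map C * (adjugate (charmatrix A') * P'.map C)) a b).coeff k = 0 := by
    simp_rw [Matrix.mul_apply (M := (P * M⁻¹).map C), finsetSum_coeff, Matrix.map_apply,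
      coeff_C_mul, Matrix.mul_apply (M := adjugate _), finsetSum_coeff, Matrix.map_apply,
      coeff_mul_C, coeff_adjugate_charmatrix A' _ _ hk]
    simp
  have h2 : ((A'.charpoly • (1 : Matrix n n ℂ[X])) a b).coeff k =
      A'.charpoly.coeff k * (1 : Matrix n n ℂ) a b := by
    by_cases h : a = b
    · subst h; simp
    · simp [h]
  rw [solitonPoly, Matrix.sub_apply, coeff_sub, h1, sub_zero, h2]

theorem natDegree_solitonPoly_le (A' M : Matrix ι ι ℂ) (P : Matrix n ι ℂ) (P' : Matrix ι n ℂ)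
    (a b : n) : (solitonPoly A' M P P' a b).natDegree ≤ Fintype.card ι := by
  refine natDegree_le_iff_coeff_eq_zero.2 fun k hk => ?_
  rw [coeff_solitonPoly _ _ _ _ _ _ hk.le, coeff_eq_zero_of_natDegree_lt, zero_mul]
  rwa [Matrix.charpoly_natDegree_eq_dim]

theorem coeff_solitonPoly_card (A' M : Matrix ι ι ℂ) (P : Matrix n ι ℂ) (P' : Matrix ι n ℂ)
    (a b : n) : (solitonPoly A' M P P' a b).coeff (Fintype.card ι) = (1 : Matrix n n ℂ) a b := by
  rw [coeff_solitonPoly _ _ _ _ _ _ le_rfl, ← Matrix.charpoly_natDegree_eq_dim A',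
    (Matrix.charpoly_monic A').coeff_natDegree, one_mul]

theorem solitonPoly_map_eval (A' M W : Matrix ι ι ℂ) (P : Matrix n ι ℂ) (P' : Matrix ι n ℂ) {z : ℂ}
    (hW : (z • 1 - A') * W = 1) :
    (solitonPoly A' M P P').map (Polynomial.eval z) =
      A'.charpoly.eval z • (1 - P * M⁻¹ * W * P') := by
  have hch : (charmatrix A').map (Polynomial.eval z) = z • 1 - A' := by
    ext i j
    by_cases h : i = j <;> simp [h]
  have hdet : A'.charpoly.eval z = (z • 1 - A').det := by
    rw [Matrix.eval_charpoly, Matrix.scalar_apply, Matrix.smul_one_eq_diagonal]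
  have hadj : (adjugate (charmatrix A')).map (Polynomial.eval z) = A'.charpoly.eval z • W := by
    have h1 := (Polynomial.evalRingHom z).map_adjugate (charmatrix A')
    simp only [RingHom.mapMatrix_apply, Polynomial.coe_evalRingHom] at h1
    have h2 := congrArg (adjugate (z • 1 - A') * ·) hW
    beta_reduce at h2
    rw [← Matrix.mul_assoc, Matrix.adjugate_mul, Matrix.smul_mul, Matrix.one_mul,
      Matrix.mul_one] at h2
    rw [h1, hch, hdet, h2]
  have hC1 : ((P * M⁻¹).map C).map (Polynomial.eval z) = P * M⁻¹ := by
    ext i j; rw [Matrix.map_apply, Matrix.map_apply, eval_C]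
  have hC2 : (P'.map C).map (Polynomial.eval z) = P' := by ext; simp
  have hmul1 : ((P * M⁻¹).map C * (adjugate (charmatrix A') * P'.map C)).map (Polynomial.eval z) =
      P * M⁻¹ * (A'.charpoly.eval z • W * P') := by
    have e1 := Matrix.map_mul (f := Polynomial.evalRingHom z) (L := (P * M⁻¹).map C)
      (M := adjugate (charmatrix A') * P'.map C)
    have e2 := Matrix.map_mul (f := Polynomial.evalRingHom z) (L := adjugate (charmatrix A'))
      (M := P'.map C)
    rw [Polynomial.coe_evalRingHom] at e1 e2
    rw [e1, e2, hC1, hC2, hadj]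
  have hone : (A'.charpoly • (1 : Matrix n n ℂ[X])).map (Polynomial.eval z) =
      A'.charpoly.eval z • 1 := by
    ext a b
    by_cases h : a = b <;> simp [h]
  have hsub : (solitonPoly A' M P P').map (Polynomial.eval z) =
      (A'.charpoly • (1 : Matrix n n ℂ[X])).map (Polynomial.eval z) -
      ((P * M⁻¹).map C * (adjugate (charmatrix A') * P'.map C)).map (Polynomial.eval z) := by
    ext a b; simp [solitonPoly]
  rw [hsub, hone, hmul1, smul_sub, Matrix.smul_mul, Matrix.mul_smul, Matrix.mul_assoc _ W]

end Degree

/-! ### The linear systems for the `p`-vectors in terms of the numerator -/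

namespace ZeroData

variable {D : ZeroData} {N : ℕ}

/-- The half of the defining property of `p`-vectors that concerns `G`. -/
structure IsHalfPVectors (G : ℂ → Matrix (Fin N) (Fin N) ℂ) (p pbar : D.Vecs N) : Prop where
  isUnit_Kbar : IsUnit (matKbar p pbar).det
  eq_soliton : ∀ z, z ∉ Set.range D.kbar →
    G z = 1 - cols p * (matKbar p pbar)⁻¹ * D.poleDbar z * rows pbar

/-- The transpose of the formula for `Γ⁻¹` is the formula for `Γ` with the zeros of each pair and
the two kinds of vectors exchanged. So each result on `Γ` alone is used twice. -/
theorem isPVectors_iff {G Ginv : ℂ → Matrix (Fin N) (Fin N) ℂ} {p pbar : D.Vecs N} :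
    IsPVectors G Ginv p pbar ↔ IsHalfPVectors G p pbar ∧
      IsHalfPVectors (D := D.dual) (fun z => (Ginv z)ᵀ) pbar p := by
  have hform : ∀ z, (1 - cols p * D.poleD z * (matK p pbar)⁻¹ * rows pbar)ᵀ =
      1 - cols (D := D.dual) pbar * (matKbar (D := D.dual) pbar p)⁻¹ * D.dual.poleDbar z *
        rows (D := D.dual) p := by
    intro z
    rw [Matrix.transpose_sub, Matrix.transpose_one, Matrix.transpose_mul, Matrix.transpose_mul,
      Matrix.transpose_mul, matKbar_dual, Matrix.transpose_nonsing_inv, poleDbar_eq_transpose,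
      Matrix.mul_assoc, Matrix.mul_assoc]
    rfl
  constructor
  · rintro ⟨h1, h2, h3, h4⟩
    refine ⟨⟨h1, h3⟩, ⟨?_, fun z hz => ?_⟩⟩
    · rw [matKbar_dual, Matrix.det_transpose]; exact h2
    · rw [← hform, h4 z hz]
  · rintro ⟨⟨h1, h3⟩, ⟨h2, h4⟩⟩
    refine ⟨h1, ?_, h3, fun z hz => ?_⟩
    · rw [matKbar_dual, Matrix.det_transpose] at h2; exact h2
    · have := h4 z hz
      rw [← hform] at this
      exact Matrix.transpose_injective this

/-- The soliton matrix, multiplied by its denominator. -/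
noncomputable def numerator (p pbar : D.Vecs N) : Matrix (Fin N) (Fin N) ℂ[X] :=
  solitonPoly D.jordanBar (matKbar p pbar) (cols p) (rows pbar)

theorem IsHalfPVectors.evalM_numerator {G : ℂ → Matrix (Fin N) (Fin N) ℂ} {p pbar : D.Vecs N}
    (h : IsHalfPVectors G p pbar) {z : ℂ} (hz : z ∉ Set.range D.kbar) :
    evalM (numerator p pbar) z = D.jordanBar.charpoly.eval z • G z := by
  rw [h.eq_soliton z hz]
  exact solitonPoly_map_eval _ _ _ _ _ (D.sub_jordanBar_mul_poleDbar hz)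

/-- Merges the linear systems of all blocks into one equation for the matrix of columns. -/
theorem polyAct_jordan_apply (F : Matrix (Fin N) (Fin N) ℂ[X]) (p : D.Vecs N) (a : Fin N)
    (ν : D.Block) (i : Fin (D.size ν)) :
    polyAct D.jordan F (cols p) a ⟨ν, i⟩ =
      (lowerToeplitz (D.size ν) (evalM F) (D.κ ν) *ᵥ stack ν p) (i, a) := by
  have hpow : ∀ f : ℂ[X], aeval D.jordan f =
      Matrix.blockDiagonal' fun ν : D.Block => aeval (jordanBlock (D.size ν) (D.κ ν)) f := by
    intro f
    induction f using Polynomial.induction_on' with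
    | add f g hf hg =>
      rw [map_add, hf, hg]
      refine (Matrix.blockDiagonal'_add _ _).symm.trans ?_
      congr 1; funext ν; simp
    | monomial k c =>
      simp_rw [aeval_monomial, jordan, ← Matrix.blockDiagonal'_pow, ← Algebra.smul_def,
        ← Matrix.blockDiagonal'_smul]
      rfl
  rw [polyAct_apply, Matrix.mulVec, dotProduct, Fintype.sum_prod_type]
  conv_rhs => rw [Finset.sum_comm]
  refine Finset.sum_congr rfl fun b _ => ?_
  rw [hpow, Fintype.sum_sigma, Finset.sum_eq_single ν]
  · refine Finset.sum_congr rfl fun j _ => ?_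
    rw [Matrix.blockDiagonal'_apply_eq, lowerToeplitz_evalM, mul_comm]
    rfl
  · intro μ _ hμ
    refine Finset.sum_eq_zero fun j _ => ?_
    rw [Matrix.blockDiagonal'_apply_ne _ _ _ hμ, mul_zero]
  · simp

theorem polyAct_jordan_eq_zero_iff (F : Matrix (Fin N) (Fin N) ℂ[X]) (p : D.Vecs N) :
    polyAct D.jordan F (cols p) = 0 ↔
      ∀ ν, lowerToeplitz (D.size ν) (evalM F) (D.κ ν) *ᵥ stack ν p = 0 := by
  constructor
  · intro h ν
    ext ⟨i, a⟩
    rw [← polyAct_jordan_apply, h]; rfl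
  · intro h
    ext a ⟨ν, i⟩
    rw [polyAct_jordan_apply, h]; rfl

theorem κ_notMem (ν : D.Block) : D.κ ν ∉ Set.range D.kbar := by
  rintro ⟨n, hn⟩
  exact D.k_ne_kbar _ _ hn.symm

/-- The numerator is `q Γ` with `q(κ_ν) ≠ 0`, and the Toeplitz matrix of `q` is an invertible left
factor. -/
theorem IsHalfPVectors.toeplitz_eq_zero_iff {G : ℂ → Matrix (Fin N) (Fin N) ℂ}
    {p pbar : D.Vecs N} (h : IsHalfPVectors G p pbar) (v : D.Vecs N) (ν : D.Block) :
    lowerToeplitz (D.size ν) G (D.κ ν) *ᵥ stack ν v = 0 ↔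
      lowerToeplitz (D.size ν) (evalM (numerator p pbar)) (D.κ ν) *ᵥ stack ν v = 0 := by
  set q := D.jordanBar.charpoly with hq
  have hqν : q.eval (D.κ ν) ≠ 0 := D.eval_charpoly_jordanBar_ne_zero (κ_notMem ν)
  have hU : ∀ᶠ z in 𝓝 (D.κ ν), z ∉ Set.range D.kbar :=
    (Set.finite_range D.kbar).isClosed.isOpen_compl.mem_nhds (κ_notMem ν)
  have hG : ∀ a b, AnalyticAt ℂ (fun z => G z a b) (D.κ ν) := by
    intro a b
    have h1 : AnalyticAt ℂ (fun z => q.eval z) (D.κ ν) := q.differentiable.analyticAt _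
    have h2 : AnalyticAt ℂ (fun z => (numerator p pbar a b).eval z) (D.κ ν) :=
      (numerator p pbar a b).differentiable.analyticAt _
    refine ((h1.fun_inv hqν).fun_mul h2).congr ?_
    filter_upwards [hU] with z hz
    have h3 := congrFun (congrFun (h.evalM_numerator hz) a) b
    rw [evalM_apply, Matrix.smul_apply, smul_eq_mul, ← hq] at h3
    rw [h3, inv_mul_cancel_left₀ (D.eval_charpoly_jordanBar_ne_zero hz)]
  have hmul := lowerToeplitz_mul (s := D.size ν) (F := evalM (q • 1)) (H := G)
    (fun a b => ((q • (1 : Matrix (Fin N) (Fin N) ℂ[X])) a b).differentiable.analyticAt _) hG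
  have hev : (fun z => evalM (q • 1) z * G z) =ᶠ[𝓝 (D.κ ν)] evalM (numerator p pbar) := by
    filter_upwards [hU] with z hz
    rw [h.evalM_numerator hz]
    have : evalM (q • (1 : Matrix (Fin N) (Fin N) ℂ[X])) z = q.eval z • 1 := by
      ext a b
      by_cases hab : a = b <;> simp [evalM_apply, hab]
    rw [this, Matrix.smul_mul, Matrix.one_mul]
  rw [lowerToeplitz_congr hev] at hmul
  obtain ⟨u, hu⟩ := isUnit_lowerToeplitz_smul_one (N := N) (s := D.size ν) hqν
  rw [hmul, ← Matrix.mulVec_mulVec, ← hu]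
  constructor
  · intro h0
    rw [h0, Matrix.mulVec_zero]
  · intro h0
    have := congrArg (fun w => (↑u⁻¹ : Matrix (Fin (D.size ν) × Fin N) _ ℂ) *ᵥ w) h0
    simpa [Matrix.mulVec_mulVec, ← Matrix.mul_assoc] using this

theorem IsHalfPVectors.kernelEq_iff_polyAct {G : ℂ → Matrix (Fin N) (Fin N) ℂ}
    {p pbar : D.Vecs N} (h : IsHalfPVectors G p pbar) (v : D.Vecs N) :
    KernelEq G v ↔ polyAct D.jordan (numerator p pbar) (cols v) = 0 := by
  rw [polyAct_jordan_eq_zero_iff]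
  exact forall_congr' fun ν => h.toeplitz_eq_zero_iff v ν

/-- The solutions of the linear system are the invariance transforms of the `p`-vectors. -/
theorem IsHalfPVectors.kernelEq_iff {G : ℂ → Matrix (Fin N) (Fin N) ℂ}
    {p pbar : D.Vecs N} (h : IsHalfPVectors G p pbar) (v : D.Vecs N) :
    KernelEq G v ↔ ∃ B, Commute D.jordan B ∧ cols v = cols p * B := by
  rw [h.kernelEq_iff_polyAct]
  exact polyAct_solitonPoly_eq_zero_iff D.isCoprime_charpoly h.isUnit_Kbar
    (matKbar_sylvester p pbar) _

theorem IsHalfPVectors.kernelEq {G : ℂ → Matrix (Fin N) (Fin N) ℂ}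
    {p pbar : D.Vecs N} (h : IsHalfPVectors G p pbar) : KernelEq G p :=
  (h.kernelEq_iff p).2 ⟨1, Commute.one_right _, (Matrix.mul_one _).symm⟩

/-- The vectors with the columns `P`. -/
def ofCols (P : Matrix (Fin N) D.Idx ℂ) : D.Vecs N := fun i a => P a i

theorem bracket_eq_stack (A : Matrix (Fin N) (Fin N) ℂ[X]) (dp p : D.Vecs N) (ν : D.Block) :
    bracket A dp p ν = stack ν (ofCols (cols dp + polyAct D.jordan A (cols p))) := by
  ext ⟨i, a⟩
  change dp ⟨ν, i⟩ a + _ = dp ⟨ν, i⟩ a + polyAct D.jordan A (cols p) a ⟨ν, i⟩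
  rw [polyAct_jordan_apply]

/-- The bracket of the derived equation is annihilated in terms of the numerator. -/
theorem IsHalfPVectors.bracket_iff {G : ℂ → Matrix (Fin N) (Fin N) ℂ}
    {p pbar : D.Vecs N} (h : IsHalfPVectors G p pbar) (A : Matrix (Fin N) (Fin N) ℂ[X])
    (dv v : D.Vecs N) :
    (∀ ν, lowerToeplitz (D.size ν) G (D.κ ν) *ᵥ bracket A dv v ν = 0) ↔
      polyAct D.jordan (numerator p pbar) (cols dv + polyAct D.jordan A (cols v)) = 0 := by
  simp_rw [bracket_eq_stack]
  exact h.kernelEq_iff_polyAct (ofCols (cols dv + polyAct D.jordan A (cols v)))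

/-- The scalar factor `det(k - Ā)` does not depend on `x`, so the numerator inherits the equation of
`Γ` at infinitely many `k`. The vectors themselves need no regularity in `x`. -/
theorem isLaxFamily {lam : Matrix (Fin N) (Fin N) ℂ[X]} {G : ℝ → ℂ → Matrix (Fin N) (Fin N) ℂ}
    {U : ℝ → Matrix (Fin N) (Fin N) ℂ[X]} {p pbar : ℝ → D.Vecs N}
    (h : ∀ x, IsHalfPVectors (G x) (p x) (pbar x))
    (hG : ∀ x z, z ∉ Set.range D.k → z ∉ Set.range D.kbar → ∀ a b,
      HasDerivAt (fun y => G y z a b) ((G x z * evalM lam z + evalM (U x) z * G x z) a b) x) :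
    IsLaxFamily (Fintype.card D.Idx) lam (fun x => numerator (p x) (pbar x)) U where
  natDegree_le x a b := natDegree_solitonPoly_le _ _ _ _ a b
  coeff_top x a b := coeff_solitonPoly_card _ _ _ _ a b
  hasDerivAt x a b := by
    refine hasDerivAt_coeff (d := Fintype.card D.Idx)
      (fun y => natDegree_solitonPoly_le _ _ _ _ a b)
      (S := (Set.range D.k ∪ Set.range D.kbar)ᶜ)
      ((Set.finite_range _).union (Set.finite_range _)).infinite_compl fun z hz => ?_
    rw [Set.mem_compl_iff, Set.mem_union, not_or] at hz
    have h1 := (hG x z hz.1 hz.2 a b).const_mul (D.jordanBar.charpoly.eval z)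
    have h2 : (fun y => (numerator (p y) (pbar y) a b).eval z) =
        fun y => D.jordanBar.charpoly.eval z * G y z a b := funext fun y =>
      congrFun (congrFun ((h y).evalM_numerator hz.2) a) b
    have h3 : evalM (numerator (p x) (pbar x) * lam + U x * numerator (p x) (pbar x)) z =
        D.jordanBar.charpoly.eval z • (G x z * evalM lam z + evalM (U x) z * G x z) := by
      rw [evalM_add, evalM_mul, evalM_mul, (h x).evalM_numerator hz.2,
        Matrix.mul_smul, Matrix.smul_mul, ← smul_add]
    have h4 := congrFun (congrFun h3 a) b
    rw [evalM_apply, Matrix.smul_apply, smul_eq_mul] at h4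
    rw [h2, h4]
    exact h1

end ZeroData

/-! ### Derivatives of inverses and of matrix exponentials -/

section MatrixCalculus

attribute [local instance] Matrix.linftyOpNormedRing Matrix.linftyOpNormedAlgebra

variable {n : Type*} [Fintype n] [DecidableEq n]

theorem hasDerivAt_matrix_of_entries {A : ℝ → Matrix n n ℂ} {A' : Matrix n n ℂ} {x : ℝ}
    (h : ∀ a b, HasDerivAt (fun y => A y a b) (A' a b) x) : HasDerivAt A A' x := by
  have h1 : A = fun y => ∑ a, ∑ b, A y a b • Matrix.single a b (1 : ℂ) := by
    funext y
    conv_lhs => rw [Matrix.matrix_eq_sum_single (A y)]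
    simp [Matrix.smul_single]
  have h2 : A' = ∑ a, ∑ b, A' a b • Matrix.single a b (1 : ℂ) := by
    conv_lhs => rw [Matrix.matrix_eq_sum_single A']
    simp [Matrix.smul_single]
  rw [h1, h2]
  exact HasDerivAt.fun_sum fun a _ => HasDerivAt.fun_sum fun b _ => (h a b).smul_const _

theorem hasDerivAt_linear {A : ℝ → Matrix n n ℂ} {A' : Matrix n n ℂ} {x : ℝ}
    (h : HasDerivAt A A' x) (l : Matrix n n ℂ →ₗ[ℝ] ℂ) :
    HasDerivAt (fun y => l (A y)) (l A') x :=
  (LinearMap.toContinuousLinearMap l).hasFDerivAt.comp_hasDerivAt x h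

/-- The derivative of the inverse of a matrix function. -/
theorem hasDerivAt_matrix_inverse {A B : ℝ → Matrix n n ℂ} {A' : Matrix n n ℂ} {x : ℝ}
    (hAB : ∀ y, A y * B y = 1) (h : ∀ a b, HasDerivAt (fun y => A y a b) (A' a b) x) (a b : n) :
    HasDerivAt (fun y => B y a b) ((-(B x * A' * B x)) a b) x := by
  let u : ℝ → (Matrix n n ℂ)ˣ := fun y => ⟨A y, B y, hAB y, mul_eq_one_comm.1 (hAB y)⟩
  have h1 := (hasFDerivAt_ringInverse (𝕜 := ℝ) (u x)).comp_hasDerivAt x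
    (hasDerivAt_matrix_of_entries h)
  have h2 : (Ring.inverse ∘ A) = B := funext fun y => Ring.inverse_unit (u y)
  rw [h2] at h1
  exact hasDerivAt_linear h1 (Matrix.entryLinearMap ℝ ℂ a b)

theorem exp_neg_mul_exp (A : Matrix n n ℂ) : NormedSpace.exp (-A) * NormedSpace.exp A = 1 := by
  rw [← Matrix.exp_add_of_commute _ _ (Commute.neg_left (Commute.refl A)), neg_add_cancel,
    NormedSpace.exp_zero]

/-- The derivative of `exp(-x L - t O) v` in `x`. -/
theorem hasDerivAt_exp_mulVec {L O : Matrix n n ℂ} (hLO : Commute L O) (v : n → ℂ) (x t : ℝ)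
    (i : n) :
    HasDerivAt (fun y : ℝ => (NormedSpace.exp (-((y : ℂ) • L) - (t : ℂ) • O) *ᵥ v) i)
      ((-L *ᵥ (NormedSpace.exp (-((x : ℂ) • L) - (t : ℂ) • O) *ᵥ v)) i) x := by
  have h1 : ∀ y : ℝ, NormedSpace.exp (-((y : ℂ) • L) - (t : ℂ) • O) =
      NormedSpace.exp (y • (-L)) * NormedSpace.exp (-((t : ℂ) • O)) := by
    intro y
    rw [sub_eq_add_neg, Matrix.exp_add_of_commute _ _
      (((hLO.smul_left (y : ℂ)).smul_right (t : ℂ)).neg_left.neg_right), smul_neg,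
      Complex.coe_smul]
  have h2 := hasDerivAt_exp_smul_const' (𝕂 := ℝ) (-L) x
  let l : Matrix n n ℂ →ₗ[ℝ] ℂ :=
    { toFun := fun M => ((M * NormedSpace.exp (-((t : ℂ) • O))) *ᵥ v) i
      map_add' := fun M M' => by rw [Matrix.add_mul, Matrix.add_mulVec]; rfl
      map_smul' := fun c M => by rw [Matrix.smul_mul, Matrix.smul_mulVec]; rfl }
  have h3 := hasDerivAt_linear h2 l
  simp_rw [h1, Matrix.mulVec_mulVec, ← Matrix.mul_assoc]
  exact h3

/-- The derivative of `exp(-x L - t O) v` in `t`. -/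
theorem hasDerivAt_exp_mulVec' {L O : Matrix n n ℂ} (hLO : Commute L O) (v : n → ℂ) (x t : ℝ)
    (i : n) :
    HasDerivAt (fun τ : ℝ => (NormedSpace.exp (-((x : ℂ) • L) - (τ : ℂ) • O) *ᵥ v) i)
      ((-O *ᵥ (NormedSpace.exp (-((x : ℂ) • L) - (t : ℂ) • O) *ᵥ v)) i) t := by
  have h1 : ∀ τ : ℝ, -((x : ℂ) • L) - (τ : ℂ) • O = -((τ : ℂ) • O) - (x : ℂ) • L :=
    fun τ => by abel
  simp_rw [h1]
  exact hasDerivAt_exp_mulVec hLO.symm v t x i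

/-- Uniqueness of the solution of a pair of compatible linear systems. -/
theorem eq_exp_mulVec {L O : Matrix n n ℂ} (hLO : Commute L O) {v : ℝ → ℝ → n → ℂ}
    (hx : ∀ x t i, HasDerivAt (fun y => v y t i) ((-L *ᵥ v x t) i) x)
    (ht : ∀ x t i, HasDerivAt (fun τ => v x τ i) ((-O *ᵥ v x t) i) t) (x t : ℝ) :
    v x t = NormedSpace.exp (-((x : ℂ) • L) - (t : ℂ) • O) *ᵥ v 0 0 := by
  set w : ℝ → ℝ → n → ℂ := fun x t =>
    v x t - NormedSpace.exp (-((x : ℂ) • L) - (t : ℂ) • O) *ᵥ v 0 0 with hw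
  -- The difference from the exponential solution vanishes on the line `t = 0` by the first system,
  -- then on every line of fixed `x` by the second.
  have h1 : ∀ x, w x 0 = 0 := linearODE_eq_zero (T := fun _ => -L)
    (fun _ _ => continuous_const)
    (fun x i => by
      rw [hw, Matrix.mulVec_sub]
      exact (hx x 0 i).sub (hasDerivAt_exp_mulVec hLO (v 0 0) x 0 i))
    (x₀ := 0) (by simp [hw])
  have h2 : w x t = 0 := linearODE_eq_zero (y := w x) (T := fun _ => -O)
    (fun _ _ => continuous_const)
    (fun t i => by
      rw [hw, Matrix.mulVec_sub]
      exact (ht x t i).sub (hasDerivAt_exp_mulVec' hLO (v 0 0) x t i))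
    (x₀ := 0) (h1 x) t
  exact sub_eq_zero.1 h2

end MatrixCalculus

/-! ### The evolution of the `p`-vectors -/

namespace ZeroData

variable {D : ZeroData} {N : ℕ} {lam om : Matrix (Fin N) (Fin N) ℂ[X]}

theorem stack_evolve (lam om : Matrix (Fin N) (Fin N) ℂ[X]) (p0 : D.Vecs N) (x t : ℝ)
    (ν : D.Block) :
    stack ν (evolve lam om p0 x t) = propagator lam om x t ν *ᵥ stack ν p0 := rfl

theorem commute_toeplitz (hcomm : Commute lam om) (s : ℕ) (z : ℂ) :
    Commute (lowerToeplitz s (evalM lam) z) (lowerToeplitz s (evalM om) z) :=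
  hcomm.map (toeplitzAlgHom s z)

theorem ext_stack {p p' : D.Vecs N} (h : ∀ ν, stack ν p = stack ν p') : p = p' := by
  funext ⟨ν, i⟩ a
  exact congrFun (h ν) (i, a)

theorem evolve_spec (hcomm : Commute lam om) (p0 : D.Vecs N) :
    PartialDiff (evolve lam om p0) ∧ EvolutionEq lam om (evolve lam om p0) := by
  have h1 := fun x t (i : D.Idx) a =>
    hasDerivAt_exp_mulVec (commute_toeplitz hcomm (D.size i.1) (D.κ i.1)) (stack i.1 p0) x t
      (i.2, a)
  have h2 := fun x t (i : D.Idx) a =>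
    hasDerivAt_exp_mulVec' (commute_toeplitz hcomm (D.size i.1) (D.κ i.1)) (stack i.1 p0) x t
      (i.2, a)
  refine ⟨fun x t i a => ⟨(h1 x t i a).differentiableAt, (h2 x t i a).differentiableAt⟩,
    fun x t ν => ⟨?_, ?_⟩⟩
  · ext ⟨i, a⟩
    have h3 := (h1 x t ⟨ν, i⟩ a).deriv
    rw [Matrix.neg_mulVec] at h3
    exact (congrArg (· + _) h3).trans (neg_add_cancel _)
  · ext ⟨i, a⟩
    have h3 := (h2 x t ⟨ν, i⟩ a).deriv
    rw [Matrix.neg_mulVec] at h3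
    exact (congrArg (· + _) h3).trans (neg_add_cancel _)

theorem eq_evolve (hcomm : Commute lam om) {p : ℝ → ℝ → D.Vecs N} (hp : PartialDiff p)
    (he : EvolutionEq lam om p) (x t : ℝ) : p x t = evolve lam om (p 0 0) x t := by
  refine ext_stack fun ν => ?_
  rw [stack_evolve]
  refine eq_exp_mulVec (commute_toeplitz hcomm (D.size ν) (D.κ ν)) (v := fun x t => stack ν (p x t))
    (fun x t j => ?_) (fun x t j => ?_) x t
  · have h1 := ((hp x t ⟨ν, j.1⟩ j.2).1).hasDerivAt
    have h2 := eq_neg_of_add_eq_zero_left (he x t ν).1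
    rw [Matrix.neg_mulVec, ← h2]
    exact h1
  · have h1 := ((hp x t ⟨ν, j.1⟩ j.2).2).hasDerivAt
    have h2 := eq_neg_of_add_eq_zero_left (he x t ν).2
    rw [Matrix.neg_mulVec, ← h2]
    exact h1

/-- The evolution equations are solved precisely by the exponentials. -/
theorem evolution_iff (hcomm : Commute lam om) (p : ℝ → ℝ → D.Vecs N) :
    (PartialDiff p ∧ EvolutionEq lam om p) ↔
      ∃ p0 : D.Vecs N, ∀ x t, p x t = evolve lam om p0 x t := by
  constructor
  · rintro ⟨h1, h2⟩
    exact ⟨p 0 0, eq_evolve hcomm h1 h2⟩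
  · rintro ⟨p0, h⟩
    obtain rfl : p = evolve lam om p0 := funext fun x => funext fun t => h x t
    exact evolve_spec hcomm p0

theorem evolve_zero (lam om : Matrix (Fin N) (Fin N) ℂ[X]) (p0 : D.Vecs N) :
    evolve lam om p0 0 0 = p0 := by
  refine ext_stack fun ν => ?_
  rw [stack_evolve, propagator]
  simp

theorem evolve_evolve_neg (lam om : Matrix (Fin N) (Fin N) ℂ[X]) (p0 : D.Vecs N) (x t : ℝ) :
    evolve lam om (evolve lam om p0 (-x) (-t)) x t = p0 := by
  refine ext_stack fun ν => ?_
  rw [stack_evolve, stack_evolve, Matrix.mulVec_mulVec]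
  have h1 : propagator lam om x t ν * propagator lam om (-x) (-t) ν = 1 := by
    have h2 := exp_neg_mul_exp ((x : ℂ) • lowerToeplitz (D.size ν) (evalM lam) (D.κ ν) +
      (t : ℂ) • lowerToeplitz (D.size ν) (evalM om) (D.κ ν))
    rw [propagator, propagator, ← h2]
    congr 2
    · abel
    · push_cast
      rw [neg_smul, neg_smul, neg_neg, sub_neg_eq_add]
  rw [h1, Matrix.one_mulVec]

theorem bracket_eq_zero_iff (A : Matrix (Fin N) (Fin N) ℂ[X]) (dp p : D.Vecs N) :
    (∀ ν, bracket A dp p ν = 0) ↔ cols dp + polyAct D.jordan A (cols p) = 0 := by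
  simp_rw [bracket_eq_stack]
  constructor
  · intro h
    ext a ⟨ν, i⟩
    exact congrFun (h ν) (i, a)
  · intro h ν
    rw [h]; rfl

/-- A constant `B` commuting with `A` passes through the evolution equations, so both sides solve
the same initial value problem. -/
theorem evolve_mul (hcomm : Commute lam om) {p0 p1 : D.Vecs N} {B : Matrix D.Idx D.Idx ℂ}
    (hB : Commute D.jordan B) (h : cols p1 = cols p0 * B) (x t : ℝ) :
    cols (evolve lam om p1 x t) = cols (evolve lam om p0 x t) * B := by
  obtain ⟨hd, he⟩ := evolve_spec hcomm p0
  set q : ℝ → ℝ → D.Vecs N := fun x t => ofCols (cols (evolve lam om p0 x t) * B) with hq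
  have hqx : ∀ x t i a, HasDerivAt (fun y => q y t i a)
      ((cols (dx (evolve lam om p0) x t) * B) a i) x := fun x t i a =>
    HasDerivAt.fun_sum fun j _ => ((hd x t j a).1.hasDerivAt).mul_const _
  have hqt : ∀ x t i a, HasDerivAt (fun τ => q x τ i a)
      ((cols (dt (evolve lam om p0) x t) * B) a i) t := fun x t i a =>
    HasDerivAt.fun_sum fun j _ => ((hd x t j a).2.hasDerivAt).mul_const _
  have h1 : PartialDiff q := fun x t i a =>
    ⟨(hqx x t i a).differentiableAt, (hqt x t i a).differentiableAt⟩
  have hdx : ∀ x t, cols (dx q x t) = cols (dx (evolve lam om p0) x t) * B := fun x t => by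
    ext a i; exact (hqx x t i a).deriv
  have hdt : ∀ x t, cols (dt q x t) = cols (dt (evolve lam om p0) x t) * B := fun x t => by
    ext a i; exact (hqt x t i a).deriv
  have hcq : ∀ x t, cols (q x t) = cols (evolve lam om p0 x t) * B := fun x t => rfl
  have h2 : EvolutionEq lam om q := fun x t ν => by
    have e1 := (bracket_eq_zero_iff lam _ _).1 fun ν => (he x t ν).1
    have e2 := (bracket_eq_zero_iff om _ _).1 fun ν => (he x t ν).2
    refine ⟨(bracket_eq_zero_iff lam _ _).2 ?_ ν, (bracket_eq_zero_iff om _ _).2 ?_ ν⟩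
    · rw [hdx, hcq, polyAct_mul_right hB, ← Matrix.add_mul, e1, Matrix.zero_mul]
    · rw [hdt, hcq, polyAct_mul_right hB, ← Matrix.add_mul, e2, Matrix.zero_mul]
  have h3 := eq_evolve hcomm h1 h2 x t
  have h4 : q 0 0 = p1 := by
    have : cols (q 0 0) = cols p1 := by rw [hcq, evolve_zero, h]
    funext i a
    exact congrFun (congrFun this a) i
  rw [← h4, ← h3]
  rfl

/-- A family of soliton matrices (with only `G` taken into account) solving the linear problems
away from the zeros. -/
structure IsSolitonFamily (lam om : Matrix (Fin N) (Fin N) ℂ[X])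
    (G : ℝ → ℝ → ℂ → Matrix (Fin N) (Fin N) ℂ) (U V : ℝ → ℝ → Matrix (Fin N) (Fin N) ℂ[X])
    (p pbar : ℝ → ℝ → D.Vecs N) : Prop where
  half : ∀ x t, IsHalfPVectors (G x t) (p x t) (pbar x t)
  hasDerivAt_x : ∀ x t z, z ∉ Set.range D.k → z ∉ Set.range D.kbar → ∀ a b,
    HasDerivAt (fun y => G y t z a b)
      ((G x t z * evalM lam z + evalM (U x t) z * G x t z) a b) x
  hasDerivAt_t : ∀ x t z, z ∉ Set.range D.k → z ∉ Set.range D.kbar → ∀ a b,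
    HasDerivAt (fun τ => G x τ z a b)
      ((G x t z * evalM om z + evalM (V x t) z * G x t z) a b) t

namespace IsSolitonFamily

variable {G : ℝ → ℝ → ℂ → Matrix (Fin N) (Fin N) ℂ} {U V : ℝ → ℝ → Matrix (Fin N) (Fin N) ℂ[X]}
  {p pbar : ℝ → ℝ → D.Vecs N}

theorem laxFamily_x (h : IsSolitonFamily lam om G U V p pbar) (t : ℝ) :
    IsLaxFamily (Fintype.card D.Idx) lam (fun x => numerator (p x t) (pbar x t))
      (fun x => U x t) :=
  isLaxFamily (G := fun x => G x t) (fun x => h.half x t) fun x => h.hasDerivAt_x x t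

theorem laxFamily_t (h : IsSolitonFamily lam om G U V p pbar) (x : ℝ) :
    IsLaxFamily (Fintype.card D.Idx) om (fun t => numerator (p x t) (pbar x t))
      (fun t => V x t) :=
  isLaxFamily (G := fun t => G x t) (fun t => h.half x t) fun t => h.hasDerivAt_t x t

/-- The derived equations. -/
theorem derivedEq (h : IsSolitonFamily lam om G U V p pbar) (hp : PartialDiff p) :
    DerivedEq lam om G p := by
  intro x t ν
  have hz : ∀ x t, polyAct D.jordan (numerator (p x t) (pbar x t)) (cols (p x t)) = 0 :=
    fun x t => ((h.half x t).kernelEq_iff_polyAct _).1 (h.half x t).kernelEq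
  refine ⟨((h.half x t).bracket_iff lam _ _).2 ?_ ν, ((h.half x t).bracket_iff om _ _).2 ?_ ν⟩
  · exact (h.laxFamily_x t).derived_eq_zero D.jordan (P := fun y => cols (p y t))
      (fun a i => (hp x t i a).1.hasDerivAt) (fun y => hz y t)
  · exact (h.laxFamily_t x).derived_eq_zero D.jordan (P := fun τ => cols (p x τ))
      (fun a i => (hp x t i a).2.hasDerivAt) (fun τ => hz x τ)

/-- The kernel is propagated by the derived equations. -/
theorem kernelEq_of_derivedEq (h : IsSolitonFamily lam om G U V p pbar) {v : ℝ → ℝ → D.Vecs N}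
    (hv : PartialDiff v) (hd : DerivedEq lam om G v) {x₀ t₀ : ℝ}
    (h₀ : KernelEq (G x₀ t₀) (v x₀ t₀)) (x t : ℝ) : KernelEq (G x t) (v x t) := by
  rw [(h.half x₀ t₀).kernelEq_iff_polyAct] at h₀
  rw [(h.half x t).kernelEq_iff_polyAct]
  have h1 := (h.laxFamily_x t₀).polyAct_eq_zero D.jordan (P := fun y => cols (v y t₀))
    (fun x a i => (hv x t₀ i a).1.hasDerivAt)
    (fun x => ((h.half x t₀).bracket_iff lam (dx v x t₀) _).1 fun ν => (hd x t₀ ν).1) h₀ x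
  exact (h.laxFamily_t x).polyAct_eq_zero D.jordan (P := fun τ => cols (v x τ))
    (fun t a i => (hv x t i a).2.hasDerivAt)
    (fun t => ((h.half x t).bracket_iff om (dt v x t) _).1 fun ν => (hd x t ν).2) h1 t

theorem kernelEq_evolve (h : IsSolitonFamily lam om G U V p pbar) (hcomm : Commute lam om)
    (p0 : D.Vecs N) {x₀ t₀ : ℝ} (h₀ : KernelEq (G x₀ t₀) (evolve lam om p0 x₀ t₀)) (x t : ℝ) :
    KernelEq (G x t) (evolve lam om p0 x t) := by
  obtain ⟨h1, h2⟩ := evolve_spec hcomm p0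
  refine h.kernelEq_of_derivedEq h1 (fun x t ν => ?_) h₀ x t
  rw [(h2 x t ν).1, (h2 x t ν).2, Matrix.mulVec_zero]
  exact ⟨rfl, rfl⟩

/-- The exponentially evolving vectors are invariance transforms of any `p`-vectors. -/
theorem exists_evolve_eq (h : IsSolitonFamily lam om G U V p pbar) (hcomm : Commute lam om)
    {p0 pbar0 : D.Vecs N} (h₀ : IsHalfPVectors (G 0 0) p0 pbar0) (x t : ℝ) :
    ∃ B, Commute D.jordan B ∧ IsUnit B.det ∧
      cols (evolve lam om p0 x t) = cols (p x t) * B := by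
  obtain ⟨B, hB, hPB⟩ := ((h.half x t).kernelEq_iff _).1
    (h.kernelEq_evolve hcomm p0 (by rw [evolve_zero]; exact h₀.kernelEq) x t)
  -- For the inverse of `B`, the `p`-vectors at `(x, t)` are carried back to the origin, where they
  -- are `p0 B'`. Carried forward again they give `P = P B B'`, and freeness of the action gives `B
  -- B' = 1`.
  have h1 := h.kernelEq_evolve hcomm (evolve lam om (p x t) (-x) (-t)) (x₀ := x) (t₀ := t)
    (by rw [evolve_evolve_neg]; exact (h.half x t).kernelEq) 0 0
  rw [evolve_zero] at h1
  obtain ⟨B', hB', hPB'⟩ := (h₀.kernelEq_iff _).1 h1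
  have h2 := evolve_mul hcomm hB' hPB' x t
  rw [evolve_evolve_neg, hPB, Matrix.mul_assoc] at h2
  have h3 : cols (p x t) * (1 - B * B') = 0 := by
    rw [Matrix.mul_sub, Matrix.mul_one, ← h2, sub_self]
  have h4 := eq_zero_of_mul_eq_zero D.isCoprime_charpoly (h.half x t).isUnit_Kbar
    (matKbar_sylvester _ _) ((Commute.one_right _).sub_right (hB.mul_right hB')) h3
  refine ⟨B, hB, ?_, hPB⟩
  have h5 := congrArg Matrix.det (sub_eq_zero.1 h4)
  rw [Matrix.det_one, Matrix.det_mul] at h5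
  exact IsUnit.of_mul_eq_one _ h5.symm

end IsSolitonFamily

end ZeroData

/-! ### Invariance transformations -/

namespace ZeroData

variable {D : ZeroData} {N : ℕ}

section Invariance

theorem isInvariance_of_commute {B : Matrix D.Idx D.Idx ℂ} (hB : Commute D.jordan B)
    (hu : IsUnit B.det) : D.IsInvariance B := by
  refine ⟨hu, fun z hz => ?_⟩
  have h1 := D.sub_jordan_mul_poleD hz
  let u : (Matrix D.Idx D.Idx ℂ)ˣ := ⟨_, _, h1, mul_eq_one_comm.1 h1⟩
  have h2 : Commute B (u : Matrix D.Idx D.Idx ℂ) :=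
    ((Commute.one_right B).smul_right z).sub_right hB.symm
  exact h2.units_inv_right

theorem isInvarianceBar_of_dual {B : Matrix D.Idx D.Idx ℂ} (h : D.dual.IsInvariance B) :
    D.IsInvarianceBar Bᵀ := by
  refine ⟨by rw [Matrix.det_transpose]; exact h.1, fun z hz => ?_⟩
  rw [poleDbar_eq_transpose, ← Matrix.transpose_mul]
  exact (congrArg Matrix.transpose (h.2 z hz)).symm.trans (Matrix.transpose_mul _ _)

/-- Both sides solve the Sylvester equation with right-hand side `rows pbar' * cols p'`, and its
solution is unique. -/
theorem matKbar_invariance {p pbar p' pbar' : D.Vecs N} {B B' : Matrix D.Idx D.Idx ℂ}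
    (hB : Commute D.jordan B) (hB' : Commute D.dual.jordan B')
    (hp : cols p' = cols p * B) (hpbar : rows pbar' = B'ᵀ * rows pbar) :
    matKbar p' pbar' = B'ᵀ * matKbar p pbar * B := by
  have hB'' : B'ᵀ * D.jordanBar = D.jordanBar * B'ᵀ := by
    rw [jordanBar, ← Matrix.transpose_mul]
    exact (congrArg Matrix.transpose hB'.eq).trans (Matrix.transpose_mul _ _)
  have h1 := matKbar_sylvester p' pbar'
  have h2 : B'ᵀ * matKbar p pbar * B * D.jordan - D.jordanBar * (B'ᵀ * matKbar p pbar * B) =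
      rows pbar' * cols p' := by
    calc B'ᵀ * matKbar p pbar * B * D.jordan - D.jordanBar * (B'ᵀ * matKbar p pbar * B)
        = B'ᵀ * matKbar p pbar * (B * D.jordan) - (D.jordanBar * B'ᵀ) * matKbar p pbar * B := by
          simp only [Matrix.mul_assoc]
      _ = B'ᵀ * (matKbar p pbar * D.jordan - D.jordanBar * matKbar p pbar) * B := by
          rw [← hB.eq, ← hB'']
          simp only [Matrix.mul_sub, Matrix.sub_mul, Matrix.mul_assoc]
      _ = rows pbar' * cols p' := by
          rw [matKbar_sylvester, hp, hpbar]
          simp only [Matrix.mul_assoc]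
  refine sub_eq_zero.1 (eq_zero_of_intertwine D.isCoprime_charpoly ?_)
  rw [← sub_eq_zero, Matrix.sub_mul, Matrix.mul_sub, ← sub_eq_zero.2 (h1.trans h2.symm)]
  abel

/-- Invariance transformations do not change the soliton matrix. -/
theorem IsHalfPVectors.of_invariance {G : ℂ → Matrix (Fin N) (Fin N) ℂ}
    {p pbar p' pbar' : D.Vecs N} (h : IsHalfPVectors G p pbar) {B B' : Matrix D.Idx D.Idx ℂ}
    (hB : Commute D.jordan B) (hBu : IsUnit B.det)
    (hB' : Commute D.dual.jordan B') (hBu' : IsUnit B'.det)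
    (hp : cols p' = cols p * B) (hpbar : rows pbar' = B'ᵀ * rows pbar) :
    IsHalfPVectors G p' pbar' := by
  have hM := matKbar_invariance hB hB' hp hpbar
  have hBt : IsUnit B'ᵀ.det := by rwa [Matrix.det_transpose]
  refine ⟨?_, fun z hz => ?_⟩
  · rw [hM, Matrix.det_mul, Matrix.det_mul]
    exact (hBt.mul h.isUnit_Kbar).mul hBu
  · have hcom := (isInvarianceBar_of_dual (isInvariance_of_commute hB' hBu')).2 z hz
    have e1 : B * B⁻¹ = 1 := Matrix.mul_nonsing_inv _ hBu
    have e2 : B'ᵀ⁻¹ * B'ᵀ = 1 := Matrix.nonsing_inv_mul _ hBt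
    rw [h.eq_soliton z hz, hM, hp, hpbar, Matrix.mul_inv_rev, Matrix.mul_inv_rev]
    congr 1
    symm
    calc cols p * B * (B⁻¹ * ((matKbar p pbar)⁻¹ * B'ᵀ⁻¹)) * D.poleDbar z * (B'ᵀ * rows pbar)
        = cols p * (B * B⁻¹) * (matKbar p pbar)⁻¹ * (B'ᵀ⁻¹ * (D.poleDbar z * B'ᵀ)) * rows pbar := by
          simp only [Matrix.mul_assoc]
      _ = cols p * (matKbar p pbar)⁻¹ * D.poleDbar z * rows pbar := by
          rw [e1, Matrix.mul_one, ← hcom, ← Matrix.mul_assoc B'ᵀ⁻¹, e2, Matrix.one_mul]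

theorem IsPVectors.of_invariance {G Ginv : ℂ → Matrix (Fin N) (Fin N) ℂ}
    {p pbar p' pbar' : D.Vecs N} (h : IsPVectors G Ginv p pbar) {B B' : Matrix D.Idx D.Idx ℂ}
    (hB : Commute D.jordan B) (hBu : IsUnit B.det)
    (hB' : Commute D.dual.jordan B') (hBu' : IsUnit B'.det)
    (hp : cols p' = cols p * B) (hpbar : rows pbar' = B'ᵀ * rows pbar) :
    IsPVectors G Ginv p' pbar' := by
  rw [isPVectors_iff] at h ⊢
  refine ⟨h.1.of_invariance hB hBu hB' hBu' hp hpbar,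
    h.2.of_invariance (D := D.dual) hB' hBu' hB hBu ?_ ?_⟩
  · exact (congrArg Matrix.transpose hpbar).trans (Matrix.transpose_mul _ _)
  · exact (congrArg Matrix.transpose hp).trans (Matrix.transpose_mul _ _)

theorem kernelEqBar_iff_dual (Ginv : ℂ → Matrix (Fin N) (Fin N) ℂ) (pbar : D.Vecs N) :
    KernelEqBar Ginv pbar ↔ KernelEq (D := D.dual) (fun z => (Ginv z)ᵀ) pbar := by
  refine forall_congr' fun ν => ?_
  rw [upperToeplitz_eq_transpose, Matrix.vecMul_transpose]
  rfl

/-- Non-degenerate solutions of the linear systems are `p`-vectors, related to any others by an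
invariance transformation. -/
theorem IsPVectors.of_kernelEq {G Ginv : ℂ → Matrix (Fin N) (Fin N) ℂ}
    {p pbar p' pbar' : D.Vecs N} (h : IsPVectors G Ginv p pbar) (hk : KernelEq G p')
    (hkbar : KernelEqBar Ginv pbar') (hu : IsUnit (matKbar p' pbar').det) :
    InvarianceRelated p pbar p' pbar' ∧ IsPVectors G Ginv p' pbar' := by
  obtain ⟨h1, h2⟩ := isPVectors_iff.1 h
  obtain ⟨B, hB, hPB⟩ := (h1.kernelEq_iff p').1 hk
  obtain ⟨B', hB', hPB'⟩ := (h2.kernelEq_iff pbar').1 ((kernelEqBar_iff_dual _ _).1 hkbar)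
  have hrow : rows pbar' = B'ᵀ * rows pbar :=
    (congrArg Matrix.transpose hPB').trans (Matrix.transpose_mul _ _)
  -- The determinant of the new `K̄` is a product, so its being a unit makes both `B` and `B'`
  -- invertible.
  rw [matKbar_invariance hB hB' hPB hrow, Matrix.det_mul, Matrix.det_mul, IsUnit.mul_iff,
    IsUnit.mul_iff, Matrix.det_transpose] at hu
  refine ⟨⟨B, B'ᵀ, isInvariance_of_commute hB hu.2,
    isInvarianceBar_of_dual (isInvariance_of_commute hB' hu.1.1), hPB, hrow⟩,
    h.of_invariance hB hu.2 hB' hu.1.1 hPB hrow⟩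

theorem IsPVectors.kernelEq {G Ginv : ℂ → Matrix (Fin N) (Fin N) ℂ}
    {p pbar : D.Vecs N} (h : IsPVectors G Ginv p pbar) : KernelEq G p :=
  (isPVectors_iff.1 h).1.kernelEq

theorem IsPVectors.kernelEqBar {G Ginv : ℂ → Matrix (Fin N) (Fin N) ℂ}
    {p pbar : D.Vecs N} (h : IsPVectors G Ginv p pbar) : KernelEqBar Ginv pbar :=
  (kernelEqBar_iff_dual _ _).2 (isPVectors_iff.1 h).2.kernelEq

end Invariance

/-! ### Transposition: from columns to rows -/

section Duality

variable (lam om : Matrix (Fin N) (Fin N) ℂ[X])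

theorem lowerToeplitz_neg_transpose (s : ℕ) (A : Matrix (Fin N) (Fin N) ℂ[X]) (z : ℂ) :
    lowerToeplitz s (evalM (-Aᵀ)) z = -(upperToeplitz s (evalM A) z)ᵀ := by
  rw [← toeplitzAlgHom_apply, map_neg]
  rfl

theorem bracketBar_eq_dual (A : Matrix (Fin N) (Fin N) ℂ[X]) (dp pbar : D.Vecs N) (ν : D.Block) :
    bracketBar A dp pbar ν = bracket (D := D.dual) (-Aᵀ) dp pbar ν := by
  have h1 : lowerToeplitz (D.dual.size ν) (evalM (-Aᵀ)) (D.dual.κ ν) =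
      -(upperToeplitz (D.size ν) (evalM A) (D.κbar ν))ᵀ := lowerToeplitz_neg_transpose _ _ _
  rw [bracketBar, bracket, h1, Matrix.neg_mulVec, Matrix.mulVec_transpose, sub_eq_add_neg]
  rfl

theorem derivedEqBar_iff_dual (Ginv : ℝ → ℝ → ℂ → Matrix (Fin N) (Fin N) ℂ)
    (pbar : ℝ → ℝ → D.Vecs N) :
    DerivedEqBar lam om Ginv pbar ↔
      DerivedEq (D := D.dual) (-lamᵀ) (-omᵀ) (fun x t z => (Ginv x t z)ᵀ) pbar := by
  refine forall_congr' fun x => forall_congr' fun t => forall_congr' fun ν => ?_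
  rw [upperToeplitz_eq_transpose, Matrix.vecMul_transpose, Matrix.vecMul_transpose,
    bracketBar_eq_dual, bracketBar_eq_dual]
  rfl

theorem evolutionEqBar_iff_dual (pbar : ℝ → ℝ → D.Vecs N) :
    EvolutionEqBar lam om pbar ↔ EvolutionEq (D := D.dual) (-lamᵀ) (-omᵀ) pbar := by
  refine forall_congr' fun x => forall_congr' fun t => forall_congr' fun ν => ?_
  rw [bracketBar_eq_dual, bracketBar_eq_dual]
  rfl

theorem propagatorBar_eq_dual (x t : ℝ) (ν : D.Block) :
    propagatorBar lam om x t ν = (propagator (D := D.dual) (-lamᵀ) (-omᵀ) x t ν)ᵀ := by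
  rw [propagator, lowerToeplitz_neg_transpose, lowerToeplitz_neg_transpose, ← Matrix.exp_transpose,
    smul_neg, smul_neg, neg_neg, sub_neg_eq_add]
  rfl

theorem evolveBar_eq_dual (pbar0 : D.Vecs N) (x t : ℝ) :
    evolveBar lam om pbar0 x t = evolve (D := D.dual) (-lamᵀ) (-omᵀ) pbar0 x t := by
  funext i a
  rw [evolveBar, propagatorBar_eq_dual, Matrix.vecMul_transpose]
  rfl

variable {lam om}

theorem commute_dual (hcomm : Commute lam om) : Commute (-lamᵀ) (-omᵀ) := by
  have h1 : Commute lamᵀ omᵀ := by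
    have := congrArg Matrix.transpose hcomm.eq
    rw [Matrix.transpose_mul, Matrix.transpose_mul] at this
    exact this.symm
  exact h1.neg_left.neg_right

/-- The linear problem for the transposed inverse. -/
theorem hasDerivAt_dual {G Ginv : ℝ → ℂ → Matrix (Fin N) (Fin N) ℂ}
    {U : Matrix (Fin N) (Fin N) ℂ[X]} {x : ℝ} {z : ℂ} (hinv : ∀ y, G y z * Ginv y z = 1)
    (h : ∀ a b, HasDerivAt (fun y => G y z a b)
      ((G x z * evalM lam z + evalM U z * G x z) a b) x) (a b : Fin N) :
    HasDerivAt (fun y => (Ginv y z)ᵀ a b)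
      (((Ginv x z)ᵀ * evalM (-lamᵀ) z + evalM (-Uᵀ) z * (Ginv x z)ᵀ) a b) x := by
  have h1 := hasDerivAt_matrix_inverse hinv h b a
  have h2 : (Ginv x z)ᵀ * evalM (-lamᵀ) z + evalM (-Uᵀ) z * (Ginv x z)ᵀ =
      (-(Ginv x z * (G x z * evalM lam z + evalM U z * G x z) * Ginv x z))ᵀ := by
    -- `Γ⁻¹ (∂Γ) Γ⁻¹ = Λ Γ⁻¹ + Γ⁻¹ U`, whose negative transpose is again of the form `F Λ + U F`,
    -- with `-Λᵀ` and `-Uᵀ`.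
    have h3 : Ginv x z * (G x z * evalM lam z + evalM U z * G x z) * Ginv x z =
        evalM lam z * Ginv x z + Ginv x z * evalM U z := by
      rw [Matrix.mul_add, Matrix.add_mul, ← Matrix.mul_assoc, mul_eq_one_comm.1 (hinv x),
        Matrix.one_mul, Matrix.mul_assoc _ _ (Ginv x z), Matrix.mul_assoc _ _ (Ginv x z), hinv,
        Matrix.mul_one]
    rw [h3, evalM_neg, evalM_neg, evalM_transpose, evalM_transpose, Matrix.transpose_neg,
      Matrix.transpose_add, Matrix.transpose_mul, Matrix.transpose_mul, Matrix.mul_neg,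
      Matrix.neg_mul, neg_add]
  rw [h2]
  exact h1

theorem isSolitonFamily_dual {G Ginv : ℝ → ℝ → ℂ → Matrix (Fin N) (Fin N) ℂ}
    {U V : ℝ → ℝ → Matrix (Fin N) (Fin N) ℂ[X]} {p pbar : ℝ → ℝ → D.Vecs N}
    (hinv : ∀ x t z, z ∉ Set.range D.k → z ∉ Set.range D.kbar → G x t z * Ginv x t z = 1)
    (hp : ∀ x t, IsPVectors (G x t) (Ginv x t) (p x t) (pbar x t))
    (h : IsSolitonFamily lam om G U V p pbar) :
    IsSolitonFamily (D := D.dual) (-lamᵀ) (-omᵀ) (fun x t z => (Ginv x t z)ᵀ)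
      (fun x t => -(U x t)ᵀ) (fun x t => -(V x t)ᵀ) pbar p where
  half x t := (isPVectors_iff.1 (hp x t)).2
  hasDerivAt_x x t z hk hkbar := hasDerivAt_dual (G := fun y => G y t) (Ginv := fun y => Ginv y t)
    (fun y => hinv y t z hkbar hk) (h.hasDerivAt_x x t z hkbar hk)
  hasDerivAt_t x t z hk hkbar := hasDerivAt_dual (G := fun τ => G x τ) (Ginv := fun τ => Ginv x τ)
    (fun τ => hinv x τ z hkbar hk) (h.hasDerivAt_t x t z hkbar hk)

end Duality

/-! ### The propagators in terms of `E` and `E⁻¹` -/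

section Exponentials

theorem propagator_eq_toeplitz (lam om : Matrix (Fin N) (Fin N) ℂ[X]) (x t : ℝ) (ν : D.Block) :
    propagator lam om x t ν = lowerToeplitz (D.size ν) (expE lam om x t) (D.κ ν) := by
  have h1 : ∀ z, evalM (-((x : ℂ) • lam) - (t : ℂ) • om) z =
      -((x : ℂ) • evalM lam z) - (t : ℂ) • evalM om z := fun z => by
    ext a b; simp [evalM_apply]
  have h2 := exp_lowerToeplitz (s := D.size ν) (-((x : ℂ) • lam) - (t : ℂ) • om) (D.κ ν)
  rw [← toeplitzAlgHom_apply, map_sub, map_neg, map_smul, map_smul] at h2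
  simp_rw [h1] at h2
  exact h2

theorem propagatorBar_eq_toeplitz (lam om : Matrix (Fin N) (Fin N) ℂ[X]) (x t : ℝ)
    (ν : D.Block) : propagatorBar lam om x t ν =
      upperToeplitz (D.size ν) (fun z => (expE lam om x t z)⁻¹) (D.κbar ν) := by
  rw [propagatorBar_eq_dual, propagator_eq_toeplitz, upperToeplitz_eq_transpose]
  have h1 : expE (-lamᵀ) (-omᵀ) x t = fun z => ((expE lam om x t z)⁻¹)ᵀ := by
    funext z
    rw [expE, expE, ← Matrix.exp_neg, ← Matrix.exp_transpose]
    congr 1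
    ext a b
    simp [evalM_apply]
    ring
  rw [h1]
  rfl

end Exponentials

end ZeroData

end Soliton

/-! ### The theorem -/

theorem mainTheorem6 (N : ℕ) (D : Soliton.ZeroData)
    (lam om : Matrix (Fin N) (Fin N) (Polynomial ℂ)) (hcomm : Commute lam om)
    (G Ginv : ℝ → ℝ → ℂ → Matrix (Fin N) (Fin N) ℂ)
    (U V : ℝ → ℝ → Matrix (Fin N) (Fin N) (Polynomial ℂ))
    (hinv : ∀ x t z, z ∉ Set.range D.k → z ∉ Set.range D.kbar → G x t z * Ginv x t z = 1)
    (hsol : ∀ x t, ∃ p pbar : D.Vecs N, Soliton.ZeroData.IsPVectors (G x t) (Ginv x t) p pbar)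
    (hx : ∀ x t z, z ∉ Set.range D.kbar → ∀ a b,
      HasDerivAt (fun y => G y t z a b)
        ((G x t z * Soliton.evalM lam z + Soliton.evalM (U x t) z * G x t z) a b) x)
    (ht : ∀ x t z, z ∉ Set.range D.kbar → ∀ a b,
      HasDerivAt (fun τ => G x τ z a b)
        ((G x t z * Soliton.evalM om z + Soliton.evalM (V x t) z * G x t z) a b) t) :
    -- the derived equations hold for all p-vectors that depend differentiably on `x` and `t`
    (∀ p pbar : ℝ → ℝ → D.Vecs N,
      (∀ x t, Soliton.ZeroData.IsPVectors (G x t) (Ginv x t) (p x t) (pbar x t)) →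
      (Soliton.ZeroData.PartialDiff p → Soliton.ZeroData.DerivedEq lam om G p) ∧
      (Soliton.ZeroData.PartialDiff pbar → Soliton.ZeroData.DerivedEqBar lam om Ginv pbar)) ∧
    -- the evolution equations are solved precisely by the exponentials
    (∀ p : ℝ → ℝ → D.Vecs N,
      (Soliton.ZeroData.PartialDiff p ∧ Soliton.ZeroData.EvolutionEq lam om p) ↔
        ∃ p0 : D.Vecs N, ∀ x t, p x t = Soliton.ZeroData.evolve lam om p0 x t) ∧
    (∀ pbar : ℝ → ℝ → D.Vecs N,
      (Soliton.ZeroData.PartialDiff pbar ∧ Soliton.ZeroData.EvolutionEqBar lam om pbar) ↔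
        ∃ pbar0 : D.Vecs N, ∀ x t, pbar x t = Soliton.ZeroData.evolveBar lam om pbar0 x t) ∧
    -- no loss of generality
    (∀ p0 pbar0 : D.Vecs N, Soliton.ZeroData.IsPVectors (G 0 0) (Ginv 0 0) p0 pbar0 →
      -- the exponentially evolving vectors are p-vectors of the soliton matrix for all `x`, `t`
      (∀ x t, Soliton.ZeroData.IsPVectors (G x t) (Ginv x t)
        (Soliton.ZeroData.evolve lam om p0 x t) (Soliton.ZeroData.evolveBar lam om pbar0 x t)) ∧
      -- all p-vectors are related to them by invariance transformations
      (∀ x t (p pbar : D.Vecs N), Soliton.ZeroData.IsPVectors (G x t) (Ginv x t) p pbar →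
        Soliton.ZeroData.InvarianceRelated
          (Soliton.ZeroData.evolve lam om p0 x t) (Soliton.ZeroData.evolveBar lam om pbar0 x t)
          p pbar) ∧
      -- and so are all non-degenerate solutions of the derived equations
      (∀ p pbar : ℝ → ℝ → D.Vecs N,
        Soliton.ZeroData.PartialDiff p → Soliton.ZeroData.PartialDiff pbar →
        Soliton.ZeroData.KernelEq (G 0 0) (p 0 0) →
        Soliton.ZeroData.KernelEqBar (Ginv 0 0) (pbar 0 0) →
        Soliton.ZeroData.DerivedEq lam om G p → Soliton.ZeroData.DerivedEqBar lam om Ginv pbar →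
        (∀ x t, IsUnit (Soliton.ZeroData.matKbar (p x t) (pbar x t)).det ∧
          IsUnit (Soliton.ZeroData.matK (p x t) (pbar x t)).det) →
        ∀ x t,
          Soliton.ZeroData.InvarianceRelated
            (Soliton.ZeroData.evolve lam om p0 x t) (Soliton.ZeroData.evolveBar lam om pbar0 x t)
            (p x t) (pbar x t) ∧
          Soliton.ZeroData.IsPVectors (G x t) (Ginv x t) (p x t) (pbar x t))) ∧
    -- the exponentials are the block-Toeplitz matrices of the derivatives of `E` and `E⁻¹`
    (∀ x t (ν : D.Block),
      Soliton.ZeroData.propagator lam om x t ν =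
        Soliton.lowerToeplitz (D.size ν) (Soliton.expE lam om x t) (D.κ ν) ∧
      Soliton.ZeroData.propagatorBar lam om x t ν =
        Soliton.upperToeplitz (D.size ν) (fun z => (Soliton.expE lam om x t z)⁻¹) (D.κbar ν)) := by
  -- These vectors may depend on `x` and `t` in any manner; only the numerator of `Γ`, never `P`
  -- itself, is differentiated.
  choose P Pbar hP using hsol
  have hfam : Soliton.ZeroData.IsSolitonFamily lam om G U V P Pbar :=
    ⟨fun x t => (Soliton.ZeroData.isPVectors_iff.1 (hP x t)).1,
      fun x t z _ hz => hx x t z hz, fun x t z _ hz => ht x t z hz⟩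
  have hdual := Soliton.ZeroData.isSolitonFamily_dual hinv hP hfam
  have hcomm' := Soliton.ZeroData.commute_dual hcomm
  refine ⟨fun p pbar hp => ⟨fun hd => ?_, fun hd => ?_⟩,
    fun p => Soliton.ZeroData.evolution_iff hcomm p, fun pbar => ?_, fun p0 pbar0 h0 => ?_,
    fun x t ν => ⟨Soliton.ZeroData.propagator_eq_toeplitz lam om x t ν,
      Soliton.ZeroData.propagatorBar_eq_toeplitz lam om x t ν⟩⟩
  · have hfam' : Soliton.ZeroData.IsSolitonFamily lam om G U V p pbar :=
      ⟨fun x t => (Soliton.ZeroData.isPVectors_iff.1 (hp x t)).1, hfam.hasDerivAt_x,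
        hfam.hasDerivAt_t⟩
    exact hfam'.derivedEq hd
  · have hfam' : Soliton.ZeroData.IsSolitonFamily lam om G U V p pbar :=
      ⟨fun x t => (Soliton.ZeroData.isPVectors_iff.1 (hp x t)).1, hfam.hasDerivAt_x,
        hfam.hasDerivAt_t⟩
    exact (Soliton.ZeroData.derivedEqBar_iff_dual lam om Ginv pbar).2
      ((Soliton.ZeroData.isSolitonFamily_dual hinv hp hfam').derivedEq hd)
  · rw [Soliton.ZeroData.evolutionEqBar_iff_dual]
    simp_rw [Soliton.ZeroData.evolveBar_eq_dual]
    exact Soliton.ZeroData.evolution_iff (D := D.dual) hcomm' pbar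
  · obtain ⟨h1, h2⟩ := Soliton.ZeroData.isPVectors_iff.1 h0
    have hev : ∀ x t, Soliton.ZeroData.IsPVectors (G x t) (Ginv x t)
        (Soliton.ZeroData.evolve lam om p0 x t)
        (Soliton.ZeroData.evolveBar lam om pbar0 x t) := by
      intro x t
      obtain ⟨B, hB, hBu, hPB⟩ := hfam.exists_evolve_eq hcomm h1 x t
      obtain ⟨B', hB', hBu', hPB'⟩ := hdual.exists_evolve_eq hcomm' h2 x t
      -- The evolved columns and rows differ from the chosen `p`-vectors by invertible `B` and
      -- `B'ᵀ`, so they give the same `Γ` and `Γ⁻¹`.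
      refine (hP x t).of_invariance hB hBu hB' hBu' hPB ?_
      rw [Soliton.ZeroData.evolveBar_eq_dual]
      exact (congrArg Matrix.transpose hPB').trans (Matrix.transpose_mul _ _)
    refine ⟨hev, fun x t p pbar hp =>
      ((hev x t).of_kernelEq hp.kernelEq hp.kernelEqBar hp.isUnit_Kbar).1, ?_⟩
    intro p pbar hpd hpbard hk hkbar hd hdbar hu x t
    refine (hev x t).of_kernelEq (hfam.kernelEq_of_derivedEq hpd hd hk x t) ?_ (hu x t).1
    rw [Soliton.ZeroData.kernelEqBar_iff_dual] at hkbar ⊢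
    exact hdual.kernelEq_of_derivedEq hpbard
      ((Soliton.ZeroData.derivedEqBar_iff_dual lam om Ginv pbar).1 hdbar) hkbar x t
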